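/- Let $n\ge 1$ and let $K,\kappa,\nu>0$. There exists a constant $C_1=C_1(K,n,\kappa,\nu)<\infty$ with the following property. Let $g$ be any function with $g(r)\ge 0$ for all $r\ge 0$, let $u_0,v_0:\mathbb{R}^n\to\mathbb{R}$ be measurable with $$0\le u_0(x)\le K,\qquad 0\le v_0(x)\le K\qquad\text{for all }x\in\mathbb{R}^n,$$ and let $(u,v)$ be a global non-negative classical solution of $$\partial_t u=\nu\Delta u-u\,g(v),\qquad \partial_t v=\kappa\Delta v+u\,g(v),\qquad t>0,\ x\in\mathbb{R}^n,$$ with initial data $u(0,x)=u_0(x)$, $v(0,x)=v_0(x)$. Then $$\|v\|_{\mathrm{pBMO}(\mathbb{R}_+\times\mathbb{R}^n)}\le C_1 .$$ In particular, $C_1$ does not depend on the function $g$. Here a global non-negative classical solution means that $u$ and $v$ are non-negative, of class $C^{1,2}$ on $(0,\infty)\times\mathbb{R}^n$ (the function, its first time derivative and its space derivatives up to order two are continuous), bounded on $(0,T]\times\mathbb{R}^n$ for every $T<\infty$, and satisfy the equations pointwise for $t>0$; the initial data are attained in the sense that $u(t,\cdot)\to u_0$ and $v(t,\cdot)\to v_0$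 in $L^1_{\mathrm{loc}}(\mathbb{R}^n)$ as $t\to0^+$. The parabolic BMO seminorm is $$\|f\|_{\mathrm{pBMO}(\mathbb{R}_+\times\mathbb{R}^n)}=\sup_Q\frac1{|Q|}\int_Q|f-(f)_Q|\,dx\,dt,\qquad (f)_Q=\frac1{|Q|}\int_Q f\,dx\,dt,$$ where $|Q|$ is the $(n+1)$-dimensional Lebesgue measure of $Q$ and the supremum is over all parabolic cylinders $Q=\{(s,y):|x-y|<R,\ |t-s|<R^2\}$, with $R>0$, $t\in\mathbb{R}$ and $x\in\mathbb{R}^n$, that are contained in $(0,\infty)\times\mathbb{R}^n$. -/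

import Mathlib

open MeasureTheory Set Filter Topology
open scoped ENNReal NNReal

/-- `n`-dimensional Euclidean space. -/
abbrev Space (n : ℕ) : Type := EuclideanSpace ℝ (Fin n)

/-- The open upper half-space `(0, ∞) × ℝⁿ` of space-time points `(t, x)`. -/
def upperHalfSpace (n : ℕ) : Set (ℝ × Space n) := Ioi 0 ×ˢ univ

/-- The parabolic cylinder of size `R` centered at `(t, x)`:
all `(s, y)` with `|x - y| < R` and `|t - s| < R ^ 2`. -/
def parabolicCylinder {n : ℕ} (R t : ℝ) (x : Space n) : Set (ℝ × Space n) :=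
  {p | ‖x - p.2‖ < R ∧ |t - p.1| < R ^ 2}

/-- The mean oscillation `|Q|⁻¹ ∫_Q |f - (f)_Q|` over `Q`, where `(f)_Q = |Q|⁻¹ ∫_Q f` and the
measure is the `(n+1)`-dimensional Lebesgue measure.  It takes values in `[0, ∞]`. -/
noncomputable def meanOscillation {n : ℕ} (f : ℝ × Space n → ℝ) (Q : Set (ℝ × Space n)) : ℝ≥0∞ :=
  (∫⁻ p in Q, ‖f p - ⨍ q in Q, f q ∂volume‖ₑ ∂volume) / volume Q

/-- The parabolic BMO seminorm of `f` on `U`: the supremum of the mean oscillations of `f` over all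
parabolic cylinders contained in `U`. -/
noncomputable def parabolicBMOSeminorm {n : ℕ} (U : Set (ℝ × Space n)) (f : ℝ × Space n → ℝ) :
    ℝ≥0∞ :=
  ⨆ (R : ℝ) (t : ℝ) (x : Space n) (_ : 0 < R) (_ : parabolicCylinder R t x ⊆ U),
    meanOscillation f (parabolicCylinder R t x)

/-- `w(t, x)` is of class `C^{1,2}` on `(0, ∞) × ℝⁿ`: the function, its first time derivative and
its first and second space derivatives exist and are jointly continuous there. -/
structure IsClassOneTwo {n : ℕ} (w : ℝ → Space n → ℝ) : Prop where
  differentiable_time : ∀ t, 0 < t → ∀ x, DifferentiableAt ℝ (fun s => w s x) t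
  contDiff_space : ∀ t, 0 < t → ContDiff ℝ 2 (w t)
  continuous_self : ContinuousOn (fun p : ℝ × Space n => w p.1 p.2) (upperHalfSpace n)
  continuous_time : ContinuousOn
    (fun p : ℝ × Space n => deriv (fun s => w s p.2) p.1) (upperHalfSpace n)
  continuous_grad : ContinuousOn
    (fun p : ℝ × Space n => fderiv ℝ (w p.1) p.2) (upperHalfSpace n)
  continuous_hess : ContinuousOn
    (fun p : ℝ × Space n => iteratedFDeriv ℝ 2 (w p.1) p.2) (upperHalfSpace n)

/-- `w(t, ·)` tends to `w₀` in `L¹_loc(ℝⁿ)` as `t → 0⁺`.  For solutions that are continuous up to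
`t = 0` this follows from `w(0, x) = w₀(x)`; it also makes sense for discontinuous `w₀`. -/
def HasInitialData {n : ℕ} (w : ℝ → Space n → ℝ) (w₀ : Space n → ℝ) : Prop :=
  ∀ R : ℝ, Tendsto (fun t => ∫⁻ x in Metric.ball (0 : Space n) R, ‖w t x - w₀ x‖ₑ ∂volume)
    (𝓝[>] 0) (𝓝 0)

/-- `(u, v)` is a global non-negative classical solution, bounded on every finite time interval, of
`∂ₜ u = ν Δ u - u g(v)`, `∂ₜ v = κ Δ v + u g(v)` on `(0, ∞) × ℝⁿ`
with initial data `(u₀, v₀)`. -/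
structure IsThermoDiffusiveSolution {n : ℕ} (ν κ : ℝ) (g : ℝ → ℝ) (u₀ v₀ : Space n → ℝ)
    (u v : ℝ → Space n → ℝ) : Prop where
  regular_u : IsClassOneTwo u
  regular_v : IsClassOneTwo v
  nonneg_u : ∀ t, 0 < t → ∀ x, 0 ≤ u t x
  nonneg_v : ∀ t, 0 < t → ∀ x, 0 ≤ v t x
  bounded : ∀ T : ℝ, ∃ M : ℝ, ∀ t, 0 < t → t ≤ T → ∀ x, u t x ≤ M ∧ v t x ≤ M
  equation_u : ∀ t, 0 < t → ∀ x,
    deriv (fun s => u s x) t = ν * Laplacian.laplacian (u t) x - u t x * g (v t x)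
  equation_v : ∀ t, 0 < t → ∀ x,
    deriv (fun s => v s x) t = κ * Laplacian.laplacian (v t) x + u t x * g (v t x)
  initial_u : HasInitialData u u₀
  initial_v : HasInitialData v v₀

/-! Write `f = u g(v) ≥ 0`. The function `g` is uncontrolled, but `f` enters both equations, and the
`u` equation limits how much of it there can be. The maximum principle gives `0 ≤ u ≤ 2K`. Testing
the `u` equation against `η(s) G`, with `G` the backward heat kernel of a diffusivity `D ≥ ν` and
pole at time `T`, bounds `∫∫ f η G` by `sup u` times quantities depending only on `η`: the
unfavourable part of `(∂ₛ + νΔ)(ηG)` is at most `(η' + nη / (2(T - s))) G`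
(`integral_reaction_mul_le`). Two weights are used.

The weight `(T - s)^(n/2)` makes this coefficient vanish. On a time interval where `T - s` varies by
a bounded factor, it bounds the reaction tested with the `κ`-kernel
(`integral_reaction_mul_heatKernel_le`). The weight `(T - s)^(-1/2)` gives a decaying estimate for
the distant past (`integral_reaction_mul_rpow_heatKernel_le`).

For a cylinder of size `R` about `(t₀, x₀)`, put `t₁ = t₀ - 2R²`. If `t₁ > 0`, let `H` be the
caloric extension of `v(t₁)`. Then `v - H ≥ 0` is the effect of the reaction after `t₁`, and the
first weight bounds its mean on balls. The function `H` is the evolution of almost initial data,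
which is bounded, plus the effect of the reaction before `t₁`. For the latter, the difference of two
`κ`-kernels is at most `C R S^(-1/2)` times a wider kernel (`exists_abs_heatKernel_sub_le`), so the
second weight bounds its oscillation (`exists_abs_caloric_sub_le`). If `t₁ ≤ 0`, the first weight
and the initial bound already control the mean of `v`. -/

/-! ### Integration by parts against radial cut-offs -/

theorem integrable_exp_neg_mul_norm_sub_sq {n : ℕ} {b : ℝ} (hb : 0 < b) (x : Space n) :
    Integrable (fun y : Space n => Real.exp (-b * ‖x - y‖ ^ 2)) := by
  have h : Integrable (fun y : Space n => Real.exp (-b * ‖y‖ ^ 2)) := by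
    apply Integrable.of_integral_ne_zero
    rw [GaussianFourier.integral_rexp_neg_mul_sq_norm hb]
    positivity
  exact h.comp_sub_left x

/-- Needed for the exponents 3 and 2: the cube is the first integer power of the positive part that
is `C²`, hence an admissible cut-off for the Laplacian. -/
theorem hasDerivAt_max_zero_pow (j : ℕ) (u : ℝ) :
    HasDerivAt (fun u : ℝ => (max 0 u) ^ (j + 2)) ((j + 2) * (max 0 u) ^ (j + 1)) u := by
  rcases lt_trichotomy u 0 with h | h | h
  · have h1 : (fun u : ℝ => (max 0 u) ^ (j + 2)) =ᶠ[𝓝 u] fun _ => 0 := by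
      filter_upwards [gt_mem_nhds h] with y hy
      simp [max_eq_left hy.le]
    rw [max_eq_left h.le]
    simpa using (hasDerivAt_const u (0 : ℝ)).congr_of_eventuallyEq h1
  · subst h
    have h1 : (fun u : ℝ => (max 0 u) ^ (j + 2)) =O[𝓝 0] fun u => ‖u - 0‖ ^ (j + 2) := by
      refine Asymptotics.IsBigO.of_bound 1 (Eventually.of_forall fun y => ?_)
      simp only [sub_zero, norm_pow, norm_norm, one_mul]
      gcongr
      rw [Real.norm_eq_abs, Real.norm_eq_abs, abs_of_nonneg (le_max_left _ _)]
      exact max_le (abs_nonneg _) (le_abs_self _)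
    have h2 := (h1.hasFDerivAt (by omega)).hasDerivAt
    simpa using h2
  · have h1 : (fun u : ℝ => (max 0 u) ^ (j + 2)) =ᶠ[𝓝 u] fun u => u ^ (j + 2) := by
      filter_upwards [lt_mem_nhds h] with y hy
      simp [max_eq_right hy.le]
    rw [max_eq_right h.le]
    have := (hasDerivAt_pow (j + 2) u).congr_of_eventuallyEq h1
    simpa using this

theorem hasLineDerivAt_comp_norm_sub_sq {n : ℕ} {q : ℝ → ℝ} {q' : ℝ} (x y : Space n) (i : Fin n)
    (hq : HasDerivAt q q' (‖x - y‖ ^ 2)) :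
    HasLineDerivAt ℝ (fun y => q (‖x - y‖ ^ 2)) (-2 * (x - y) i * q') y
      (EuclideanSpace.single i 1) := by
  have h1 : HasDerivAt (fun t : ℝ => ‖x - (y + t • (EuclideanSpace.single i 1 : Space n))‖ ^ 2)
      (-2 * (x - y) i) 0 := by
    have h2 : HasDerivAt (fun t : ℝ => x - (y + t • (EuclideanSpace.single i 1 : Space n)))
        (-(EuclideanSpace.single i 1 : Space n)) 0 := by
      have := (((hasDerivAt_id (0 : ℝ)).smul_const
        (EuclideanSpace.single i 1 : Space n)).const_add y).const_sub x
      simpa using this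
    have h3 := h2.norm_sq
    convert h3 using 1
    simp [inner_neg_right, EuclideanSpace.inner_single_right]
    ring
  have h4 : HasDerivAt q q' (‖x - (y + (0 : ℝ) • (EuclideanSpace.single i 1 : Space n))‖ ^ 2) := by
    simpa using hq
  have h5 := h4.comp (0 : ℝ) h1
  rw [HasLineDerivAt]
  exact h5.congr_deriv (mul_comm _ _)

theorem integrable_of_eq_zero_of_le_norm_sub_sq {n : ℕ} {f : Space n → ℝ} (hf : Continuous f)
    (x : Space n) (ρ : ℝ) (h0 : ∀ y, ρ ≤ ‖x - y‖ ^ 2 → f y = 0) : Integrable f := by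
  refine hf.integrable_of_hasCompactSupport
    (HasCompactSupport.intro (isCompact_closedBall x (Real.sqrt ρ)) fun y hy => h0 y ?_)
  rw [Metric.mem_closedBall, dist_comm, dist_eq_norm, not_le] at hy
  exact (Real.lt_sq_of_sqrt_lt hy).le

theorem laplacian_eq_sum_iteratedFDeriv {n : ℕ} (f : Space n → ℝ) (y : Space n) :
    Laplacian.laplacian f y = ∑ i : Fin n, iteratedFDeriv ℝ 2 f y
      ![EuclideanSpace.single i 1, EuclideanSpace.single i 1] := by
  rw [InnerProductSpace.laplacian_eq_iteratedFDeriv_orthonormalBasis f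
    (EuclideanSpace.basisFun (Fin n) ℝ)]
  simp

/-- Green's identity against a compactly supported radial function. -/
theorem integral_laplacian_mul_radial {n : ℕ} {f : Space n → ℝ} (hf : ContDiff ℝ 2 f) (x : Space n)
    {q q' q'' : ℝ → ℝ} (hq : ∀ r, HasDerivAt q (q' r) r) (hq' : ∀ r, HasDerivAt q' (q'' r) r)
    (hc : Continuous q'') {ρ : ℝ} (h0 : ∀ r, ρ ≤ r → q r = 0) (h1 : ∀ r, ρ ≤ r → q' r = 0)
    (h2 : ∀ r, ρ ≤ r → q'' r = 0) :
    ∫ y, Laplacian.laplacian f y * q (‖x - y‖ ^ 2) =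
      ∫ y, f y * (4 * ‖x - y‖ ^ 2 * q'' (‖x - y‖ ^ 2) + 2 * n * q' (‖x - y‖ ^ 2)) := by
  have cq : Continuous q := continuous_iff_continuousAt.2 fun r => (hq r).continuousAt
  have cq' : Continuous q' := continuous_iff_continuousAt.2 fun r => (hq' r).continuousAt
  have cf := hf.continuous
  have cf1 : Continuous (fderiv ℝ f) := hf.continuous_fderiv (by norm_num)
  have df1 : Differentiable ℝ (fderiv ℝ f) :=
    (hf.fderiv_right (m := 1) (by norm_num)).differentiable (by norm_num)
  have cf2 : Continuous (fderiv ℝ (fderiv ℝ f)) :=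
    (hf.fderiv_right (m := 1) (by norm_num)).continuous_fderiv (by norm_num)
  set e : Fin n → Space n := fun i => EuclideanSpace.single i 1 with he
  have key : ∀ i, Integrable (fun y => iteratedFDeriv ℝ 2 f y ![e i, e i] * q (‖x - y‖ ^ 2)) ∧
      Integrable (fun y => f y * (4 * (x - y) i ^ 2 * q'' (‖x - y‖ ^ 2) + 2 * q' (‖x - y‖ ^ 2))) ∧
      ∫ y, iteratedFDeriv ℝ 2 f y ![e i, e i] * q (‖x - y‖ ^ 2) =
      ∫ y, f y * (4 * (x - y) i ^ 2 * q'' (‖x - y‖ ^ 2) + 2 * q' (‖x - y‖ ^ 2)) := by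
    intro i
    have e2 : ∀ y, iteratedFDeriv ℝ 2 f y ![e i, e i] = fderiv ℝ (fderiv ℝ f) y (e i) (e i) := by
      intro y; simp [iteratedFDeriv_two_apply]
    simp_rw [e2]
    have I1 : Integrable (fun y => fderiv ℝ (fderiv ℝ f) y (e i) (e i) * q (‖x - y‖ ^ 2)) :=
      integrable_of_eq_zero_of_le_norm_sub_sq (by fun_prop) x ρ (fun y hy => by simp [h0 _ hy])
    have I2 : Integrable (fun y => fderiv ℝ f y (e i) * (-2 * (x - y) i * q' (‖x - y‖ ^ 2))) :=
      integrable_of_eq_zero_of_le_norm_sub_sq (by fun_prop) x ρ (fun y hy => by simp [h1 _ hy])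
    have I3 : Integrable (fun y => fderiv ℝ f y (e i) * q (‖x - y‖ ^ 2)) :=
      integrable_of_eq_zero_of_le_norm_sub_sq (by fun_prop) x ρ (fun y hy => by simp [h0 _ hy])
    have I4 : Integrable (fun y => f y * (-2 * (x - y) i * q' (‖x - y‖ ^ 2))) :=
      integrable_of_eq_zero_of_le_norm_sub_sq (by fun_prop) x ρ (fun y hy => by simp [h1 _ hy])
    have I5 : Integrable (fun y => f y *
        (4 * (x - y) i ^ 2 * q'' (‖x - y‖ ^ 2) + 2 * q' (‖x - y‖ ^ 2))) :=
      integrable_of_eq_zero_of_le_norm_sub_sq (by fun_prop) x ρ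
        (fun y hy => by simp [h1 _ hy, h2 _ hy])
    -- `A` moves one derivative in direction `e i` onto the radial factor, `B` moves the other; the
    -- two signs cancel.
    have A := integral_bilinear_hasLineDerivAt_right_eq_neg_left_of_integrable
      (μ := volume) (f := fun y => fderiv ℝ f y (e i))
      (f' := fun y => fderiv ℝ (fderiv ℝ f) y (e i) (e i))
      (g := fun y => q (‖x - y‖ ^ 2)) (g' := fun y => -2 * (x - y) i * q' (‖x - y‖ ^ 2))
      (v := e i) (B := ContinuousLinearMap.mul ℝ ℝ) I1 I2 I3
      (fun y _ => by
        have := ((df1 y).hasFDerivAt.clm_apply (hasFDerivAt_const (e i) y)).hasLineDerivAt (e i)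
        simpa using this)
      (fun y _ => hasLineDerivAt_comp_norm_sub_sq x y i (hq _))
    have B := integral_bilinear_hasLineDerivAt_right_eq_neg_left_of_integrable
      (μ := volume) (f := f) (f' := fun y => fderiv ℝ f y (e i))
      (g := fun y => -2 * (x - y) i * q' (‖x - y‖ ^ 2))
      (g' := fun y => 4 * (x - y) i ^ 2 * q'' (‖x - y‖ ^ 2) + 2 * q' (‖x - y‖ ^ 2))
      (v := e i) (B := ContinuousLinearMap.mul ℝ ℝ) I2 I5 I4
      (fun y _ => ((hf.differentiable (by norm_num)) y).hasFDerivAt.hasLineDerivAt (e i))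
      (fun y _ => by
        have a1 := hasLineDerivAt_comp_norm_sub_sq x y i (hq' (‖x - y‖ ^ 2))
        have a2 : HasDerivAt (fun t : ℝ => -2 * (x - (y + t • e i)) i) 2 0 := by
          have : (fun t : ℝ => -2 * (x - (y + t • e i)) i) = fun t => -2 * (x - y) i + t * 2 := by
            funext t
            simp [he]
            ring
          rw [this]
          simpa using ((hasDerivAt_id (0 : ℝ)).mul_const 2).const_add (-2 * (x - y) i)
        rw [HasLineDerivAt] at a1 ⊢
        refine (a2.mul a1).congr_deriv ?_
        simp
        ring)
    simp only [ContinuousLinearMap.mul_apply'] at A B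
    refine ⟨I1, I5, ?_⟩
    rw [B, A, neg_neg]
  have L : ∀ y, Laplacian.laplacian f y * q (‖x - y‖ ^ 2) =
      ∑ i, iteratedFDeriv ℝ 2 f y ![e i, e i] * q (‖x - y‖ ^ 2) := by
    intro y
    rw [laplacian_eq_sum_iteratedFDeriv, Finset.sum_mul]
  have R : ∀ y, f y * (4 * ‖x - y‖ ^ 2 * q'' (‖x - y‖ ^ 2) + 2 * n * q' (‖x - y‖ ^ 2)) =
      ∑ i, f y * (4 * (x - y) i ^ 2 * q'' (‖x - y‖ ^ 2) + 2 * q' (‖x - y‖ ^ 2)) := by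
    intro y
    rw [← Finset.mul_sum, Finset.sum_add_distrib, ← Finset.sum_mul, ← Finset.mul_sum,
      ← EuclideanSpace.real_norm_sq_eq]
    simp only [Finset.sum_const, Finset.card_univ, Fintype.card_fin, nsmul_eq_mul]
    ring
  simp_rw [L, R]
  rw [integral_finsetSum _ fun i _ => (key i).1, integral_finsetSum _ fun i _ => (key i).2.1]
  exact Finset.sum_congr rfl fun i _ => (key i).2.2


/-! ### Space-time identity with a truncated Gaussian -/

/-- The slab `(t₁, t₂] × ℝⁿ` with Lebesgue measure. -/
noncomputable abbrev slabMeasure (n : ℕ) (t₁ t₂ : ℝ) : Measure (ℝ × Space n) :=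
  (volume.restrict (Ioc t₁ t₂)).prod volume

theorem slabMeasure_eq_restrict (n : ℕ) (t₁ t₂ : ℝ) :
    slabMeasure n t₁ t₂ = (volume : Measure (ℝ × Space n)).restrict (Ioc t₁ t₂ ×ˢ univ) := by
  rw [Measure.volume_eq_prod, ← Measure.prod_restrict, Measure.restrict_univ]

theorem aestronglyMeasurable_slabMeasure {n : ℕ} {t₁ t₂ : ℝ} {f : ℝ × Space n → ℝ}
    (hf : ContinuousOn f (Icc t₁ t₂ ×ˢ univ)) :
    AEStronglyMeasurable f (slabMeasure n t₁ t₂) := by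
  rw [slabMeasure_eq_restrict]
  exact (hf.mono (prod_mono Ioc_subset_Icc_self subset_rfl)).aestronglyMeasurable
    (measurableSet_Ioc.prod MeasurableSet.univ)

theorem ae_slabMeasure {n : ℕ} {t₁ t₂ : ℝ} {p : ℝ × Space n → Prop}
    (h : ∀ s ∈ Icc t₁ t₂, ∀ y, p (s, y)) : ∀ᵐ z ∂slabMeasure n t₁ t₂, p z := by
  rw [slabMeasure_eq_restrict]
  refine (ae_restrict_mem (measurableSet_Ioc.prod MeasurableSet.univ)).mono ?_
  rintro ⟨s, y⟩ hz
  exact h s (Ioc_subset_Icc_self hz.1) y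

theorem integrable_slabMeasure_of_eq_zero {n : ℕ} {t₁ t₂ : ℝ} {f : ℝ × Space n → ℝ}
    (hf : ContinuousOn f (Icc t₁ t₂ ×ˢ univ)) (x : Space n) (ρ : ℝ)
    (h0 : ∀ p : ℝ × Space n, ρ ≤ ‖x - p.2‖ ^ 2 → f p = 0) :
    Integrable f (slabMeasure n t₁ t₂) := by
  rw [slabMeasure_eq_restrict]
  have h1 : IntegrableOn f (Icc t₁ t₂ ×ˢ Metric.closedBall x (Real.sqrt ρ)) :=
    (hf.mono (prod_mono subset_rfl (subset_univ _))).integrableOn_compact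
      (isCompact_Icc.prod (isCompact_closedBall _ _))
  refine IntegrableOn.mono_set (IntegrableOn.of_forall_sdiff_eq_zero h1
    (t := Icc t₁ t₂ ×ˢ univ) (measurableSet_Icc.prod MeasurableSet.univ) ?_)
    (prod_mono Ioc_subset_Icc_self subset_rfl)
  rintro ⟨s, y⟩ ⟨hs, hy⟩
  refine h0 _ ?_
  have : y ∉ Metric.closedBall x (Real.sqrt ρ) := fun h => hy ⟨hs.1, h⟩
  rw [Metric.mem_closedBall, dist_comm, dist_eq_norm, not_le] at this
  exact (Real.lt_sq_of_sqrt_lt this).le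

/-- The Gaussian profile `A exp (-b r)`, cut off at `r = 1 / k`. -/
noncomputable def gaussCut (A b k r : ℝ) : ℝ := A * Real.exp (-b * r) * (max 0 (1 - k * r)) ^ 3

/-- The backward heat operator `∂ₛ + a Δ` applied to `gaussCut (A s) (b s) k (‖x - y‖ ^ 2)`. -/
noncomputable def backwardHeatGaussCut (n : ℕ) (a A A' b b' k r : ℝ) : ℝ :=
  Real.exp (-b * r) * ((A' - A * b' * r) * (max 0 (1 - k * r)) ^ 3 +
    a * A * (4 * r * (6 * k ^ 2 * max 0 (1 - k * r) + 6 * b * k * (max 0 (1 - k * r)) ^ 2 +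
      b ^ 2 * (max 0 (1 - k * r)) ^ 3) +
      2 * n * (-3 * k * (max 0 (1 - k * r)) ^ 2 - b * (max 0 (1 - k * r)) ^ 3)))

theorem continuousOn_gaussCut {X : Type*} [TopologicalSpace X] {S : Set X} {A b r : X → ℝ} (k : ℝ)
    (hA : ContinuousOn A S) (hb : ContinuousOn b S) (hr : ContinuousOn r S) :
    ContinuousOn (fun p => gaussCut (A p) (b p) k (r p)) S := by
  have h : Continuous fun z : ℝ × ℝ × ℝ => gaussCut z.1 z.2.1 k z.2.2 := by
    unfold gaussCut; fun_prop
  exact h.comp_continuousOn (hA.prodMk (hb.prodMk hr))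

theorem continuousOn_backwardHeatGaussCut {X : Type*} [TopologicalSpace X] {S : Set X} (n : ℕ)
    (a : ℝ) {A A' b b' r : X → ℝ} (k : ℝ) (hA : ContinuousOn A S) (hA' : ContinuousOn A' S)
    (hb : ContinuousOn b S) (hb' : ContinuousOn b' S) (hr : ContinuousOn r S) :
    ContinuousOn (fun p => backwardHeatGaussCut n a (A p) (A' p) (b p) (b' p) k (r p)) S := by
  have h : Continuous fun z : ℝ × ℝ × ℝ × ℝ × ℝ =>
      backwardHeatGaussCut n a z.1 z.2.1 z.2.2.1 z.2.2.2.1 k z.2.2.2.2 := by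
    unfold backwardHeatGaussCut; fun_prop
  exact h.comp_continuousOn (hA.prodMk (hA'.prodMk (hb.prodMk (hb'.prodMk hr))))

theorem integral_laplacian_mul_gaussCut {n : ℕ} {f : Space n → ℝ} (hf : ContDiff ℝ 2 f)
    (x : Space n) (A b : ℝ) {k : ℝ} (hk : 0 < k) :
    ∫ y, Laplacian.laplacian f y * gaussCut A b k (‖x - y‖ ^ 2) =
      ∫ y, f y * backwardHeatGaussCut n 1 A 0 b 0 k (‖x - y‖ ^ 2) := by
  have hm : ∀ (j : ℕ) (r : ℝ), HasDerivAt (fun r => (max 0 (1 - k * r)) ^ (j + 2))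
      (-k * ((j + 2) * (max 0 (1 - k * r)) ^ (j + 1))) r := by
    intro j r
    have h1 : HasDerivAt (fun r => 1 - k * r) (-k) r := by
      simpa using ((hasDerivAt_id r).const_mul k).const_sub 1
    exact ((hasDerivAt_max_zero_pow j (1 - k * r)).comp r h1).congr_deriv (mul_comm _ _)
  have he : ∀ r, HasDerivAt (fun r => A * Real.exp (-b * r)) (A * Real.exp (-b * r) * -b) r := by
    intro r
    have h1 : HasDerivAt (fun r => -b * r) (-b) r := by
      simpa using (hasDerivAt_id r).const_mul (-b)
    exact (h1.exp.const_mul A).congr_deriv (by ring)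
  have hz : ∀ r, k⁻¹ ≤ r → max 0 (1 - k * r) = 0 := by
    intro r hr
    apply max_eq_left
    have : 1 ≤ k * r := by
      calc 1 = k * k⁻¹ := by field_simp
        _ ≤ k * r := by gcongr
    linarith
  have := integral_laplacian_mul_radial hf x (q := gaussCut A b k)
    (q' := fun r => A * Real.exp (-b * r) * (-3 * k * (max 0 (1 - k * r)) ^ 2
      - b * (max 0 (1 - k * r)) ^ 3))
    (q'' := fun r => A * Real.exp (-b * r) * (6 * k ^ 2 * max 0 (1 - k * r) +
      6 * b * k * (max 0 (1 - k * r)) ^ 2 + b ^ 2 * (max 0 (1 - k * r)) ^ 3))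
    (fun r => by
      refine ((he r).mul (hm 1 r)).congr_deriv ?_
      push_cast
      ring)
    (fun r => by
      refine ((he r).mul (((hm 0 r).const_mul (-3 * k)).sub ((hm 1 r).const_mul b))).congr_deriv ?_
      simp only [Pi.sub_apply]
      push_cast
      ring)
    (by fun_prop) (ρ := k⁻¹) (fun r hr => by simp [gaussCut, hz r hr])
    (fun r hr => by simp [hz r hr]) (fun r hr => by simp [hz r hr])
  rw [this]
  refine integral_congr_ae (Eventually.of_forall fun y => ?_)
  simp only [backwardHeatGaussCut]
  ring

theorem IsClassOneTwo.continuousOn_laplacian {n : ℕ} {w : ℝ → Space n → ℝ} (hw : IsClassOneTwo w) :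
    ContinuousOn (fun p : ℝ × Space n => Laplacian.laplacian (w p.1) p.2) (upperHalfSpace n) := by
  simp_rw [laplacian_eq_sum_iteratedFDeriv]
  refine continuousOn_finsetSum _ fun i _ => ?_
  exact (ContinuousMultilinearMap.apply ℝ (fun _ : Fin 2 => Space n) ℝ
    ![EuclideanSpace.single i 1, EuclideanSpace.single i 1]).continuous.comp_continuousOn
    hw.continuous_hess

/-- The fundamental theorem of calculus in time at each fixed `y`, then Fubini and Green's identity
on each slice. The cut-off makes every integrand compactly supported in space, so no growth bound on
the derivatives of `w` or on `F` is needed. -/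
theorem gaussCut_identity {n : ℕ} {a σ t₁ t₂ k : ℝ} {w F : ℝ → Space n → ℝ}
    {A A' b b' : ℝ → ℝ} (hw : IsClassOneTwo w) (ht₁ : 0 < t₁) (ht : t₁ ≤ t₂) (hσ : σ ≠ 0)
    (heq : ∀ t ∈ Icc t₁ t₂, ∀ x,
      deriv (fun s => w s x) t = a * Laplacian.laplacian (w t) x + σ * F t x)
    (hA : ∀ s ∈ Icc t₁ t₂, HasDerivAt A (A' s) s) (hb : ∀ s ∈ Icc t₁ t₂, HasDerivAt b (b' s) s)
    (hA' : ContinuousOn A' (Icc t₁ t₂)) (hb' : ContinuousOn b' (Icc t₁ t₂)) (x : Space n)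
    (hk : 0 < k) :
    (∫ y, w t₂ y * gaussCut (A t₂) (b t₂) k (‖x - y‖ ^ 2)) -
      ∫ y, w t₁ y * gaussCut (A t₁) (b t₁) k (‖x - y‖ ^ 2) =
    (∫ p, w p.1 p.2 * backwardHeatGaussCut n a (A p.1) (A' p.1) (b p.1) (b' p.1) k (‖x - p.2‖ ^ 2)
      ∂slabMeasure n t₁ t₂) +
    σ * ∫ p, F p.1 p.2 * gaussCut (A p.1) (b p.1) k (‖x - p.2‖ ^ 2) ∂slabMeasure n t₁ t₂ := by
  set S : Set (ℝ × Space n) := Icc t₁ t₂ ×ˢ univ with hS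
  have hpos : ∀ s ∈ Icc t₁ t₂, 0 < s := fun s hs => ht₁.trans_le hs.1
  have hSU : S ⊆ upperHalfSpace n := prod_mono (fun s hs => hpos s hs) subset_rfl
  have cw := hw.continuous_self.mono hSU
  have cwt := hw.continuous_time.mono hSU
  have cL := hw.continuousOn_laplacian.mono hSU
  have lift : ∀ {f : ℝ → ℝ}, ContinuousOn f (Icc t₁ t₂) →
      ContinuousOn (fun p : ℝ × Space n => f p.1) S := fun h =>
    h.comp continuousOn_fst fun p hp => hp.1
  have cA := lift fun s hs => (hA s hs).continuousAt.continuousWithinAt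
  have cb := lift fun s hs => (hb s hs).continuousAt.continuousWithinAt
  have cA' := lift hA'
  have cb' := lift hb'
  -- The forcing is continuous because the equation expresses it through derivatives of `w`; this is
  -- what allows an arbitrary `g`.
  have cF : ContinuousOn (fun p : ℝ × Space n => F p.1 p.2) S := by
    have : ContinuousOn (fun p : ℝ × Space n => σ⁻¹ * (deriv (fun s => w s p.2) p.1 -
      a * Laplacian.laplacian (w p.1) p.2)) S := by fun_prop
    refine this.congr ?_
    rintro ⟨s, y⟩ hp
    simp only
    rw [heq s hp.1]
    field_simp
    ring
  have hz : ∀ r, k⁻¹ ≤ r → max 0 (1 - k * r) = 0 := by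
    intro r hr
    apply max_eq_left
    have : 1 ≤ k * r := by
      calc 1 = k * k⁻¹ := by field_simp
        _ ≤ k * r := by gcongr
    linarith
  have cr : ContinuousOn (fun p : ℝ × Space n => ‖x - p.2‖ ^ 2) S := by fun_prop
  have cQ : ContinuousOn (fun p : ℝ × Space n =>
      gaussCut (A p.1) (b p.1) k (‖x - p.2‖ ^ 2)) S :=
    continuousOn_gaussCut k cA cb cr
  have I1 : Integrable (fun p : ℝ × Space n => Laplacian.laplacian (w p.1) p.2 *
      gaussCut (A p.1) (b p.1) k (‖x - p.2‖ ^ 2)) (slabMeasure n t₁ t₂) :=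
    integrable_slabMeasure_of_eq_zero (cL.mul cQ) x k⁻¹
      fun p hp => by simp [gaussCut, hz _ hp]
  have I2 : Integrable (fun p : ℝ × Space n => F p.1 p.2 *
      gaussCut (A p.1) (b p.1) k (‖x - p.2‖ ^ 2)) (slabMeasure n t₁ t₂) :=
    integrable_slabMeasure_of_eq_zero (cF.mul cQ) x k⁻¹
      fun p hp => by simp [gaussCut, hz _ hp]
  -- In `backwardHeatGaussCut`, `a = 0` leaves the pure time derivative; in `I4`, `a = 1` with zero
  -- `A'` and `b'` leaves the pure Laplacian. The operator is affine in `a`, so the two recombine at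
  -- the end.
  have I3 : Integrable (fun p : ℝ × Space n => w p.1 p.2 *
      backwardHeatGaussCut n 0 (A p.1) (A' p.1) (b p.1) (b' p.1) k (‖x - p.2‖ ^ 2))
      (slabMeasure n t₁ t₂) := by
    refine integrable_slabMeasure_of_eq_zero (cw.mul (continuousOn_backwardHeatGaussCut n 0 k cA cA' cb cb' cr)) x k⁻¹
      fun p hp => by simp [backwardHeatGaussCut, hz _ hp]
  have I4 : Integrable (fun p : ℝ × Space n => w p.1 p.2 *
      backwardHeatGaussCut n 1 (A p.1) 0 (b p.1) 0 k (‖x - p.2‖ ^ 2)) (slabMeasure n t₁ t₂) := by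
    refine integrable_slabMeasure_of_eq_zero (cw.mul (continuousOn_backwardHeatGaussCut n 1 k cA
      continuousOn_const cb continuousOn_const cr)) x k⁻¹
      fun p hp => by simp [backwardHeatGaussCut, hz _ hp]
  have I5 : Integrable (fun p : ℝ × Space n =>
      deriv (fun s => w s p.2) p.1 * gaussCut (A p.1) (b p.1) k (‖x - p.2‖ ^ 2) + w p.1 p.2 *
      backwardHeatGaussCut n 0 (A p.1) (A' p.1) (b p.1) (b' p.1) k (‖x - p.2‖ ^ 2))
      (slabMeasure n t₁ t₂) :=
    Integrable.add (integrable_slabMeasure_of_eq_zero (cwt.mul cQ) x k⁻¹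
      fun p hp => by simp [gaussCut, hz _ hp]) I3
  have J : ∀ t ∈ Icc t₁ t₂, Integrable fun y => w t y * gaussCut (A t) (b t) k (‖x - y‖ ^ 2) := by
    intro t h
    refine integrable_of_eq_zero_of_le_norm_sub_sq ?_ x k⁻¹ fun p hp => by simp [gaussCut, hz _ hp]
    have := (hw.contDiff_space t (hpos t h)).continuous
    unfold gaussCut
    fun_prop
  have FTC : ∀ y, w t₂ y * gaussCut (A t₂) (b t₂) k (‖x - y‖ ^ 2) -
      w t₁ y * gaussCut (A t₁) (b t₁) k (‖x - y‖ ^ 2) = ∫ s in Ioc t₁ t₂,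
      (deriv (fun s => w s y) s * gaussCut (A s) (b s) k (‖x - y‖ ^ 2) + w s y *
      backwardHeatGaussCut n 0 (A s) (A' s) (b s) (b' s) k (‖x - y‖ ^ 2)) := by
    intro y
    rw [← intervalIntegral.integral_of_le ht]
    symm
    refine intervalIntegral.integral_eq_sub_of_hasDerivAt
      (f := fun s => w s y * gaussCut (A s) (b s) k (‖x - y‖ ^ 2)) ?_ ?_
    · intro s hs
      rw [uIcc_of_le ht] at hs
      have h1 := (hw.differentiable_time s (hpos s hs) y).hasDerivAt
      have h2 : HasDerivAt (fun s => gaussCut (A s) (b s) k (‖x - y‖ ^ 2))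
          (backwardHeatGaussCut n 0 (A s) (A' s) (b s) (b' s) k (‖x - y‖ ^ 2)) s := by
        have h3 := ((hb s hs).neg.mul_const (‖x - y‖ ^ 2)).exp
        refine (((hA s hs).mul h3).mul_const _).congr_deriv ?_
        unfold backwardHeatGaussCut
        simp
        ring
      exact h1.mul h2
    · refine ContinuousOn.intervalIntegrable ?_
      rw [uIcc_of_le ht]
      have sl : ∀ {f : ℝ × Space n → ℝ}, ContinuousOn f S →
          ContinuousOn (fun s => f (s, y)) (Icc t₁ t₂) := fun h =>
        h.comp (Continuous.continuousOn (by fun_prop)) fun s hs => ⟨hs, mem_univ _⟩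
      refine ((sl cwt).mul (sl cQ)).add ((sl cw).mul (sl (f := fun p => backwardHeatGaussCut n 0
        (A p.1) (A' p.1) (b p.1) (b' p.1) k (‖x - p.2‖ ^ 2))
        (continuousOn_backwardHeatGaussCut n 0 k cA cA' cb cb' cr)))
  rw [← integral_sub (J t₂ ⟨ht, le_rfl⟩) (J t₁ ⟨le_rfl, ht⟩)]
  simp_rw [FTC]
  rw [← integral_integral_swap (f := fun s y => deriv (fun s => w s y) s *
      gaussCut (A s) (b s) k (‖x - y‖ ^ 2) + w s y *
      backwardHeatGaussCut n 0 (A s) (A' s) (b s) (b' s) k (‖x - y‖ ^ 2)) I5,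
    integral_integral I5]
  have E1 : ∫ p : ℝ × Space n, Laplacian.laplacian (w p.1) p.2 *
      gaussCut (A p.1) (b p.1) k (‖x - p.2‖ ^ 2) ∂(slabMeasure n t₁ t₂) =
      ∫ p, w p.1 p.2 * backwardHeatGaussCut n 1 (A p.1) 0 (b p.1) 0 k (‖x - p.2‖ ^ 2)
      ∂(slabMeasure n t₁ t₂) := by
    rw [integral_prod _ I1, integral_prod _ I4]
    refine setIntegral_congr_fun measurableSet_Ioc fun s hs => ?_
    exact integral_laplacian_mul_gaussCut
      (hw.contDiff_space s (hpos s (Ioc_subset_Icc_self hs))) x (A s) (b s) hk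
  calc _ = ∫ p : ℝ × Space n, (a * (Laplacian.laplacian (w p.1) p.2 *
      gaussCut (A p.1) (b p.1) k (‖x - p.2‖ ^ 2)) + σ * (F p.1 p.2 *
      gaussCut (A p.1) (b p.1) k (‖x - p.2‖ ^ 2))) + w p.1 p.2 *
      backwardHeatGaussCut n 0 (A p.1) (A' p.1) (b p.1) (b' p.1) k (‖x - p.2‖ ^ 2)
      ∂(slabMeasure n t₁ t₂) := by
        refine integral_congr_ae (ae_slabMeasure fun s hs y => ?_)
        simp only [heq s hs]
        ring
    _ = _ := by
        have I12 : Integrable (fun p : ℝ × Space n => a * (Laplacian.laplacian (w p.1) p.2 *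
            gaussCut (A p.1) (b p.1) k (‖x - p.2‖ ^ 2)) + σ * (F p.1 p.2 *
            gaussCut (A p.1) (b p.1) k (‖x - p.2‖ ^ 2))) (slabMeasure n t₁ t₂) :=
          (I1.const_mul a).add (I2.const_mul σ)
        rw [integral_add I12 I3,
          integral_add (I1.const_mul a) (I2.const_mul σ), integral_const_mul, integral_const_mul,
          E1, ← integral_const_mul, add_right_comm, ← integral_add (I4.const_mul a) I3]
        congr 1
        refine integral_congr_ae (Eventually.of_forall fun p => ?_)
        unfold backwardHeatGaussCut
        simp
        ring


/-! ### Removing the cut-off -/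

theorem abs_gaussCut_le {A b k r : ℝ} (hk : 0 ≤ k) (hr : 0 ≤ r) :
    |gaussCut A b k r| ≤ |A| * Real.exp (-b * r) := by
  have m0 : 0 ≤ max 0 (1 - k * r) := le_max_left _ _
  have m1 : max 0 (1 - k * r) ≤ 1 := max_le zero_le_one (by nlinarith [mul_nonneg hk hr])
  rw [gaussCut, abs_mul, abs_mul, abs_of_pos (Real.exp_pos _), abs_of_nonneg (pow_nonneg m0 3)]
  exact mul_le_of_le_one_right (by positivity) (pow_le_one₀ m0 m1)

/-- The bound is uniform in `k ≤ 1`. The dangerous terms, where `r` meets derivatives of the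
cut-off, contain `k r m` with `m = max 0 (1 - k r)`, and `k r ≤ 1` wherever `m ≠ 0`. -/
theorem abs_backwardHeatGaussCut_le (n : ℕ) (a : ℝ) {A A' b b' k r B : ℝ} (hk : 0 ≤ k) (hk1 : k ≤ 1)
    (hr : 0 ≤ r) (hA : |A| ≤ B) (hA' : |A'| ≤ B) (hb : |b| ≤ B) (hb' : |b'| ≤ B) :
    |backwardHeatGaussCut n a A A' b b' k r| ≤
      (B + B * B + |a| * B * (24 + 24 * B + 4 * B ^ 2 + 2 * n * (3 + B))) *
        ((1 + r) * Real.exp (-b * r)) := by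
  have hB : 0 ≤ B := (abs_nonneg _).trans hA
  unfold backwardHeatGaussCut
  set m := max 0 (1 - k * r) with hm
  have m0 : 0 ≤ m := le_max_left _ _
  have m1 : m ≤ 1 := max_le zero_le_one (by nlinarith [mul_nonneg hk hr])
  have m2 : m ^ 2 ≤ 1 := pow_le_one₀ m0 m1
  have m3 : m ^ 3 ≤ 1 := pow_le_one₀ m0 m1
  have P0 : 0 ≤ k * r * m := by positivity
  have P1 : k * r * m ≤ 1 := by
    rcases le_total (1 - k * r) 0 with h | h
    · have : m = 0 := max_eq_left h
      rw [this]; norm_num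
    · exact mul_le_one₀ (by linarith) m0 m1
  have T1 : |(A' - A * b' * r) * m ^ 3| ≤ B + B * B * r := by
    rw [abs_mul, abs_of_nonneg (pow_nonneg m0 3)]
    refine (mul_le_of_le_one_right (abs_nonneg _) m3).trans ((abs_sub _ _).trans ?_)
    rw [abs_mul, abs_mul, abs_of_nonneg hr]
    gcongr
  have T2 : |4 * r * (6 * k ^ 2 * m + 6 * b * k * m ^ 2 + b ^ 2 * m ^ 3) +
      2 * n * (-3 * k * m ^ 2 - b * m ^ 3)| ≤
      24 + 24 * B + 4 * B ^ 2 * r + 2 * n * (3 + B) := by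
    have e : 4 * r * (6 * k ^ 2 * m + 6 * b * k * m ^ 2 + b ^ 2 * m ^ 3) +
        2 * n * (-3 * k * m ^ 2 - b * m ^ 3) = 24 * (k * (k * r * m)) +
        24 * (b * ((k * r * m) * m)) + 4 * b ^ 2 * r * m ^ 3 +
        2 * n * (-(3 * k * m ^ 2) - b * m ^ 3) := by ring
    have b1 : |24 * (k * (k * r * m))| ≤ 24 := by
      rw [abs_of_nonneg (by positivity)]
      have := mul_le_one₀ hk1 P0 P1
      linarith
    have b2 : |24 * (b * ((k * r * m) * m))| ≤ 24 * B := by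
      rw [abs_mul, abs_mul, abs_of_nonneg (show 0 ≤ (k * r * m) * m by positivity)]
      have h1 := mul_le_one₀ P1 m0 m1
      have h2 := mul_le_of_le_one_right (abs_nonneg b) h1
      rw [abs_of_pos (by norm_num : (0 : ℝ) < 24)]
      linarith
    have b3 : |4 * b ^ 2 * r * m ^ 3| ≤ 4 * B ^ 2 * r := by
      rw [abs_of_nonneg (by positivity), ← sq_abs b]
      refine (mul_le_of_le_one_right (by positivity) m3).trans ?_
      gcongr
    have b4 : |2 * n * (-(3 * k * m ^ 2) - b * m ^ 3)| ≤ 2 * n * (3 + B) := by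
      rw [abs_mul, abs_of_nonneg (show (0 : ℝ) ≤ 2 * n by positivity)]
      gcongr
      refine (abs_sub _ _).trans ?_
      rw [abs_neg, abs_of_nonneg (by positivity), abs_mul, abs_of_nonneg (pow_nonneg m0 3)]
      have h1 := mul_le_one₀ hk1 (by positivity) m2
      have h2 := mul_le_of_le_one_right (abs_nonneg b) m3
      linarith
    rw [e]
    exact (abs_add_le _ _).trans (add_le_add ((abs_add_le _ _).trans
      (add_le_add ((abs_add_le _ _).trans (add_le_add b1 b2)) b3)) b4)
  rw [abs_mul, abs_of_pos (Real.exp_pos _), mul_comm, ← mul_assoc]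
  gcongr
  refine (abs_add_le _ _).trans ?_
  rw [abs_mul (a * A), abs_mul a]
  have T3 : |a| * |A| * |4 * r * (6 * k ^ 2 * m + 6 * b * k * m ^ 2 + b ^ 2 * m ^ 3) +
      2 * n * (-3 * k * m ^ 2 - b * m ^ 3)| ≤
      |a| * B * ((24 + 24 * B + 4 * B ^ 2 + 2 * n * (3 + B)) * (1 + r)) := by
    gcongr
    refine T2.trans ?_
    have h1 : 0 ≤ B * r := by positivity
    have h2 : 0 ≤ B ^ 2 * r := by positivity
    have h3 : (0 : ℝ) ≤ n * (3 + B) * r := by positivity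
    nlinarith
  have h1 : 0 ≤ B * r := by positivity
  nlinarith

/-- Half of the exponential decay absorbs the linear factor; the other half remains as an integrable
majorant. -/
theorem one_add_mul_exp_neg_le {b₀ b r : ℝ} (hb₀ : 0 < b₀) (hb : b₀ ≤ b) (hr : 0 ≤ r) :
    (1 + r) * Real.exp (-b * r) ≤ (1 + 2 / b₀) * Real.exp (-(b₀ / 2) * r) := by
  have h1 : Real.exp (-b * r) ≤ Real.exp (-(b₀ / 2) * r) * Real.exp (-(b₀ / 2) * r) := by
    rw [← Real.exp_add]
    apply Real.exp_le_exp.2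
    nlinarith
  have h2 : (1 + r) * Real.exp (-(b₀ / 2) * r) ≤ 1 + 2 / b₀ := by
    have h3 : Real.exp (-(b₀ / 2) * r) = (Real.exp (b₀ / 2 * r))⁻¹ := by
      rw [← Real.exp_neg]; ring_nf
    rw [h3, ← div_eq_mul_inv, div_le_iff₀ (Real.exp_pos _)]
    have h4 := Real.add_one_le_exp (b₀ / 2 * r)
    have h5 : r = 2 / b₀ * (b₀ / 2 * r) := by field_simp
    have h6 : 0 ≤ b₀ / 2 * r := by positivity
    have h7 : 0 < 2 / b₀ := by positivity
    nlinarith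
  calc (1 + r) * Real.exp (-b * r)
      ≤ (1 + r) * (Real.exp (-(b₀ / 2) * r) * Real.exp (-(b₀ / 2) * r)) := by gcongr
    _ = ((1 + r) * Real.exp (-(b₀ / 2) * r)) * Real.exp (-(b₀ / 2) * r) := by ring
    _ ≤ _ := by gcongr

theorem integrable_slabMeasure_gaussian {n : ℕ} {b : ℝ} (hb : 0 < b) (t₁ t₂ C : ℝ) (x : Space n) :
    Integrable (fun p : ℝ × Space n => C * Real.exp (-b * ‖x - p.2‖ ^ 2)) (slabMeasure n t₁ t₂) :=
  ((integrable_exp_neg_mul_norm_sub_sq hb x).const_mul C).comp_snd _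

theorem tendsto_gaussCut (A b r : ℝ) :
    Tendsto (fun j : ℕ => gaussCut A b (1 / ((j : ℝ) + 1)) r) atTop (𝓝 (gaussCut A b 0 r)) := by
  have : Continuous fun k => gaussCut A b k r := by unfold gaussCut; fun_prop
  exact (this.tendsto 0).comp tendsto_one_div_add_atTop_nhds_zero_nat

theorem tendsto_backwardHeatGaussCut (n : ℕ) (a A A' b b' r : ℝ) :
    Tendsto (fun j : ℕ => backwardHeatGaussCut n a A A' b b' (1 / ((j : ℝ) + 1)) r) atTop
      (𝓝 (backwardHeatGaussCut n a A A' b b' 0 r)) := by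
  have : Continuous fun k => backwardHeatGaussCut n a A A' b b' k r := by
    unfold backwardHeatGaussCut; fun_prop
  exact (this.tendsto 0).comp tendsto_one_div_add_atTop_nhds_zero_nat

/-- Testing a forced heat equation, with a forcing term of one sign, against a Gaussian. -/
theorem gaussian_identity {n : ℕ} {a σ t₁ t₂ M b₀ : ℝ} {w F : ℝ → Space n → ℝ}
    {A A' b b' : ℝ → ℝ} (hw : IsClassOneTwo w) (ht₁ : 0 < t₁) (ht : t₁ ≤ t₂) (hσ : σ ≠ 0)
    (heq : ∀ t ∈ Icc t₁ t₂, ∀ x,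
      deriv (fun s => w s x) t = a * Laplacian.laplacian (w t) x + σ * F t x)
    (hM : ∀ t ∈ Icc t₁ t₂, ∀ x, |w t x| ≤ M) (hF : ∀ t ∈ Icc t₁ t₂, ∀ x, 0 ≤ F t x)
    (hA : ∀ s ∈ Icc t₁ t₂, HasDerivAt A (A' s) s) (hb : ∀ s ∈ Icc t₁ t₂, HasDerivAt b (b' s) s)
    (hA' : ContinuousOn A' (Icc t₁ t₂)) (hb' : ContinuousOn b' (Icc t₁ t₂))
    (hA0 : ∀ s ∈ Icc t₁ t₂, 0 ≤ A s) (hb₀ : 0 < b₀) (hb0 : ∀ s ∈ Icc t₁ t₂, b₀ ≤ b s)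
    (x : Space n) :
    Integrable (fun p : ℝ × Space n => F p.1 p.2 * gaussCut (A p.1) (b p.1) 0 (‖x - p.2‖ ^ 2))
      (slabMeasure n t₁ t₂) ∧
    (∫ y, w t₂ y * gaussCut (A t₂) (b t₂) 0 (‖x - y‖ ^ 2)) -
      ∫ y, w t₁ y * gaussCut (A t₁) (b t₁) 0 (‖x - y‖ ^ 2) =
    (∫ p, w p.1 p.2 * backwardHeatGaussCut n a (A p.1) (A' p.1) (b p.1) (b' p.1) 0 (‖x - p.2‖ ^ 2)
      ∂slabMeasure n t₁ t₂) +
    σ * ∫ p, F p.1 p.2 * gaussCut (A p.1) (b p.1) 0 (‖x - p.2‖ ^ 2) ∂slabMeasure n t₁ t₂ := by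
  set S : Set (ℝ × Space n) := Icc t₁ t₂ ×ˢ univ with hS
  have hpos : ∀ s ∈ Icc t₁ t₂, 0 < s := fun s hs => ht₁.trans_le hs.1
  have hSU : S ⊆ upperHalfSpace n := prod_mono (fun s hs => hpos s hs) subset_rfl
  have cw := hw.continuous_self.mono hSU
  have cwt := hw.continuous_time.mono hSU
  have cL := hw.continuousOn_laplacian.mono hSU
  have lift : ∀ {f : ℝ → ℝ}, ContinuousOn f (Icc t₁ t₂) →
      ContinuousOn (fun p : ℝ × Space n => f p.1) S := fun h =>
    h.comp continuousOn_fst fun p hp => hp.1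
  have kA : ContinuousOn A (Icc t₁ t₂) := fun s hs => (hA s hs).continuousAt.continuousWithinAt
  have kb : ContinuousOn b (Icc t₁ t₂) := fun s hs => (hb s hs).continuousAt.continuousWithinAt
  have cr : ContinuousOn (fun p : ℝ × Space n => ‖x - p.2‖ ^ 2) S := by fun_prop
  have cF : ContinuousOn (fun p : ℝ × Space n => F p.1 p.2) S := by
    have : ContinuousOn (fun p : ℝ × Space n => σ⁻¹ * (deriv (fun s => w s p.2) p.1 -
      a * Laplacian.laplacian (w p.1) p.2)) S := by fun_prop
    refine this.congr ?_
    rintro ⟨s, y⟩ hp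
    simp only
    rw [heq s hp.1]
    field_simp
    ring
  obtain ⟨B1, hB1⟩ := isCompact_Icc.exists_bound_of_continuousOn kA
  obtain ⟨B2, hB2⟩ := isCompact_Icc.exists_bound_of_continuousOn hA'
  obtain ⟨B3, hB3⟩ := isCompact_Icc.exists_bound_of_continuousOn kb
  obtain ⟨B4, hB4⟩ := isCompact_Icc.exists_bound_of_continuousOn hb'
  obtain ⟨B, b1, b2, b3, b4⟩ : ∃ B, B1 ≤ B ∧ B2 ≤ B ∧ B3 ≤ B ∧ B4 ≤ B :=
    ⟨max (max B1 B2) (max B3 B4), by simp, by simp, by simp, by simp⟩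
  have M0 : 0 ≤ M := (abs_nonneg _).trans (hM t₁ ⟨le_rfl, ht⟩ x)
  set k : ℕ → ℝ := fun j => 1 / ((j : ℝ) + 1) with hk
  have k0 : ∀ j, 0 < k j := fun j => by simp only [hk]; positivity
  have k1 : ∀ j, k j ≤ 1 := fun j => by
    simp only [hk]
    rw [div_le_one (by positivity)]
    linarith [(Nat.cast_nonneg j : (0 : ℝ) ≤ j)]
  have L1 : ∀ t ∈ Icc t₁ t₂, Tendsto (fun j => ∫ y, w t y * gaussCut (A t) (b t) (k j) (‖x - y‖ ^ 2))
      atTop (𝓝 (∫ y, w t y * gaussCut (A t) (b t) 0 (‖x - y‖ ^ 2))) := by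
    intro t h
    have cwt := (hw.contDiff_space t (hpos t h)).continuous
    refine tendsto_integral_of_dominated_convergence
      (fun y => M * |A t| * Real.exp (-b t * ‖x - y‖ ^ 2)) (fun j => ?_)
      ((integrable_exp_neg_mul_norm_sub_sq (hb₀.trans_le (hb0 t h)) x).const_mul _) (fun j => ?_) ?_
    · refine Continuous.aestronglyMeasurable ?_
      unfold gaussCut
      fun_prop
    · refine Eventually.of_forall fun y => ?_
      rw [Real.norm_eq_abs, abs_mul, mul_assoc]
      exact mul_le_mul (hM t h y) (abs_gaussCut_le (k0 j).le (by positivity)) (abs_nonneg _) M0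
    · exact Eventually.of_forall fun y => (tendsto_gaussCut _ _ _).const_mul _
  have L2 : Tendsto (fun j => ∫ p : ℝ × Space n, w p.1 p.2 * backwardHeatGaussCut n a (A p.1)
      (A' p.1) (b p.1) (b' p.1) (k j) (‖x - p.2‖ ^ 2) ∂slabMeasure n t₁ t₂) atTop
      (𝓝 (∫ p : ℝ × Space n, w p.1 p.2 * backwardHeatGaussCut n a (A p.1)
      (A' p.1) (b p.1) (b' p.1) 0 (‖x - p.2‖ ^ 2) ∂slabMeasure n t₁ t₂)) := by
    refine tendsto_integral_of_dominated_convergence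
      (fun p => (M * ((B + B * B + |a| * B * (24 + 24 * B + 4 * B ^ 2 + 2 * n * (3 + B))) *
        (1 + 2 / b₀))) * Real.exp (-(b₀ / 2) * ‖x - p.2‖ ^ 2)) (fun j => ?_)
      (integrable_slabMeasure_gaussian (by positivity) _ _ _ x) (fun j => ?_) ?_
    · exact aestronglyMeasurable_slabMeasure (cw.mul (continuousOn_backwardHeatGaussCut n a (k j)
        (lift kA) (lift hA') (lift kb) (lift hb') cr))
    · refine ae_slabMeasure fun s hs y => ?_
      have hB : 0 ≤ B := (norm_nonneg _).trans ((hB1 s hs).trans b1)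
      rw [Real.norm_eq_abs, abs_mul, mul_assoc, mul_assoc]
      refine mul_le_mul (hM s hs y) ?_ (abs_nonneg _) M0
      refine (abs_backwardHeatGaussCut_le n a (k0 j).le (k1 j) (by positivity)
        ((hB1 s hs).trans b1) ((hB2 s hs).trans b2) ((hB3 s hs).trans b3)
        ((hB4 s hs).trans b4)).trans ?_
      refine mul_le_mul_of_nonneg_left
        (one_add_mul_exp_neg_le hb₀ (hb0 s hs) (by positivity)) (by positivity)
    · exact Eventually.of_forall fun y => (tendsto_backwardHeatGaussCut _ _ _ _ _ _ _).const_mul _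
  have id := fun j => gaussCut_identity hw ht₁ ht hσ heq hA hb hA' hb' x (k0 j)
  set ℓ := σ⁻¹ * ((∫ y, w t₂ y * gaussCut (A t₂) (b t₂) 0 (‖x - y‖ ^ 2)) -
      (∫ y, w t₁ y * gaussCut (A t₁) (b t₁) 0 (‖x - y‖ ^ 2)) -
      (∫ p, w p.1 p.2 * backwardHeatGaussCut n a (A p.1) (A' p.1) (b p.1) (b' p.1) 0
      (‖x - p.2‖ ^ 2) ∂slabMeasure n t₁ t₂)) with hℓ
  -- There is no majorant for `F` yet. Its truncated integrals converge because every other term of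
  -- the truncated identity does.
  have L3 : Tendsto (fun j => ∫ p : ℝ × Space n, F p.1 p.2 * gaussCut (A p.1) (b p.1) (k j)
      (‖x - p.2‖ ^ 2) ∂slabMeasure n t₁ t₂) atTop (𝓝 ℓ) := by
    refine ((((L1 t₂ ⟨ht, le_rfl⟩).sub (L1 t₁ ⟨le_rfl, ht⟩)).sub L2).const_mul σ⁻¹).congr
      fun j => ?_
    rw [id j]
    field_simp
    ring
  have mF : ∀ κ, AEStronglyMeasurable (fun p : ℝ × Space n => F p.1 p.2 * gaussCut (A p.1) (b p.1) κ
      (‖x - p.2‖ ^ 2)) (slabMeasure n t₁ t₂) := fun κ =>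
    aestronglyMeasurable_slabMeasure (cF.mul (continuousOn_gaussCut κ (lift kA) (lift kb) cr))
  have pos : ∀ κ, ∀ s ∈ Icc t₁ t₂, ∀ y : Space n,
      0 ≤ F s y * gaussCut (A s) (b s) κ (‖x - y‖ ^ 2) := by
    intro κ s hs y
    have := hF s hs y
    have := hA0 s hs
    unfold gaussCut
    positivity
  -- Since `F ≥ 0`, Fatou's lemma and the finite limit `ℓ` give integrability without cut-off. The
  -- untruncated integrand then dominates the truncated ones, which identifies the limit in `L4`.
  have I0 : Integrable (fun p : ℝ × Space n => F p.1 p.2 * gaussCut (A p.1) (b p.1) 0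
      (‖x - p.2‖ ^ 2)) (slabMeasure n t₁ t₂) := by
    refine ⟨mF 0, ?_⟩
    rw [hasFiniteIntegral_iff_ofReal (ae_slabMeasure (pos 0))]
    have fatou := lintegral_liminf_le' (u := atTop) (μ := slabMeasure n t₁ t₂) (f := fun (j : ℕ)
      (p : ℝ × Space n) => ENNReal.ofReal (F p.1 p.2 * gaussCut (A p.1) (b p.1) (k j)
      (‖x - p.2‖ ^ 2))) (fun j => (mF (k j)).aemeasurable.ennreal_ofReal)
    have e1 : ∀ p : ℝ × Space n, liminf (fun j => ENNReal.ofReal (F p.1 p.2 * gaussCut (A p.1)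
        (b p.1) (k j) (‖x - p.2‖ ^ 2))) atTop =
        ENNReal.ofReal (F p.1 p.2 * gaussCut (A p.1) (b p.1) 0 (‖x - p.2‖ ^ 2)) := fun p =>
      (ENNReal.tendsto_ofReal ((tendsto_gaussCut _ _ _).const_mul _)).liminf_eq
    have cQ := fun j => continuousOn_gaussCut (k j) (lift kA) (lift kb) cr
    have Ij : ∀ j, Integrable (fun p : ℝ × Space n => F p.1 p.2 * gaussCut (A p.1) (b p.1) (k j)
        (‖x - p.2‖ ^ 2)) (slabMeasure n t₁ t₂) := fun j => by
      refine integrable_slabMeasure_of_eq_zero (cF.mul (cQ j)) x (k j)⁻¹ fun p hp => ?_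
      have : max 0 (1 - k j * ‖x - p.2‖ ^ 2) = 0 := by
        apply max_eq_left
        have h := mul_le_mul_of_nonneg_left hp (k0 j).le
        rw [mul_inv_cancel₀ (k0 j).ne'] at h
        linarith
      simp [gaussCut, this]
    have e2 : ∀ j, ∫⁻ p : ℝ × Space n, ENNReal.ofReal (F p.1 p.2 * gaussCut (A p.1) (b p.1) (k j)
        (‖x - p.2‖ ^ 2)) ∂slabMeasure n t₁ t₂ = ENNReal.ofReal (∫ p : ℝ × Space n, F p.1 p.2 *
        gaussCut (A p.1) (b p.1) (k j) (‖x - p.2‖ ^ 2) ∂slabMeasure n t₁ t₂) := fun j =>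
      (ofReal_integral_eq_lintegral_ofReal (Ij j) (ae_slabMeasure (pos (k j)))).symm
    simp_rw [e1, e2] at fatou
    rw [(ENNReal.tendsto_ofReal L3).liminf_eq] at fatou
    exact fatou.trans_lt ENNReal.ofReal_lt_top
  have L4 : Tendsto (fun j => ∫ p : ℝ × Space n, F p.1 p.2 * gaussCut (A p.1) (b p.1) (k j)
      (‖x - p.2‖ ^ 2) ∂slabMeasure n t₁ t₂) atTop (𝓝 (∫ p : ℝ × Space n, F p.1 p.2 *
      gaussCut (A p.1) (b p.1) 0 (‖x - p.2‖ ^ 2) ∂slabMeasure n t₁ t₂)) := by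
    refine tendsto_integral_of_dominated_convergence (fun p : ℝ × Space n => F p.1 p.2 *
      gaussCut (A p.1) (b p.1) 0 (‖x - p.2‖ ^ 2)) (fun j => mF (k j)) I0 (fun j => ?_)
      (Eventually.of_forall fun y => (tendsto_gaussCut _ _ _).const_mul _)
    refine ae_slabMeasure fun s hs y => ?_
    rw [Real.norm_eq_abs, abs_of_nonneg (pos _ s hs y)]
    have h1 : gaussCut (A s) (b s) (k j) (‖x - y‖ ^ 2) ≤ gaussCut (A s) (b s) 0 (‖x - y‖ ^ 2) := by
      have := abs_gaussCut_le (A := A s) (b := b s) (k0 j).le (sq_nonneg ‖x - y‖)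
      rw [abs_of_nonneg (hA0 s hs)] at this
      simpa [gaussCut] using (le_abs_self _).trans this
    exact mul_le_mul_of_nonneg_left h1 (hF s hs y)
  refine ⟨I0, ?_⟩
  rw [tendsto_nhds_unique L4 L3, hℓ]
  field_simp
  ring


/-! ### The heat kernel -/

/-- The Gaussian probability density `(π θ)^(-n/2) exp (-‖z‖² / θ)`; the heat kernel of `∂ₜ - D Δ` at
time `τ` is the case `θ = 4 D τ`. -/
noncomputable def heatKernel {n : ℕ} (θ : ℝ) (z : Space n) : ℝ :=
  (Real.pi * θ) ^ (-(n / 2 : ℝ)) * Real.exp (-‖z‖ ^ 2 / θ)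

theorem heatKernel_pos {n : ℕ} {θ : ℝ} (hθ : 0 < θ) (z : Space n) : 0 < heatKernel θ z := by
  unfold heatKernel
  positivity

theorem continuous_heatKernel {n : ℕ} (θ : ℝ) : Continuous (heatKernel θ : Space n → ℝ) := by
  unfold heatKernel
  fun_prop

theorem heatKernel_eq_gaussCut {n : ℕ} (c θ : ℝ) (z : Space n) :
    c * heatKernel θ z = gaussCut (c * (Real.pi * θ) ^ (-(n / 2 : ℝ))) (1 / θ) 0 (‖z‖ ^ 2) := by
  simp only [heatKernel, gaussCut]
  simp
  ring_nf

theorem integrable_heatKernel {n : ℕ} {θ : ℝ} (hθ : 0 < θ) (x : Space n) :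
    Integrable (fun y => heatKernel θ (x - y)) := by
  refine ((integrable_exp_neg_mul_norm_sub_sq (b := 1 / θ) (by positivity) x).const_mul
    ((Real.pi * θ) ^ (-(n / 2 : ℝ)))).congr (Eventually.of_forall fun y => ?_)
  simp only [heatKernel]
  ring_nf

theorem integral_heatKernel_self {n : ℕ} {θ : ℝ} (hθ : 0 < θ) :
    ∫ y : Space n, heatKernel θ y = 1 := by
  have h := GaussianFourier.integral_rexp_neg_mul_sq_norm (V := Space n) (b := 1 / θ) (by positivity)
  have e : ∀ y : Space n, heatKernel θ y =
      (Real.pi * θ) ^ (-(n / 2 : ℝ)) * Real.exp (-(1 / θ) * ‖y‖ ^ 2) := by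
    intro y
    simp only [heatKernel]
    ring_nf
  simp_rw [e]
  rw [integral_const_mul, h, finrank_euclideanSpace, Fintype.card_fin, div_div_eq_mul_div, div_one,
    ← Real.rpow_add (by positivity)]
  simp

theorem integral_heatKernel {n : ℕ} {θ : ℝ} (hθ : 0 < θ) (x : Space n) :
    ∫ y, heatKernel θ (x - y) = 1 := by
  rw [integral_sub_left_eq_self (fun y => heatKernel θ y) volume x, integral_heatKernel_self hθ]

theorem integrable_mul_heatKernel {n : ℕ} {θ M : ℝ} (hθ : 0 < θ) (x : Space n) {f : Space n → ℝ}
    (hf : Continuous f) (hM : ∀ y, |f y| ≤ M) : Integrable (fun y => f y * heatKernel θ (x - y)) :=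
  (integrable_heatKernel hθ x).bdd_mul hf.aestronglyMeasurable (Eventually.of_forall hM)

theorem heatKernel_le {n : ℕ} {θ : ℝ} (hθ : 0 < θ) (z : Space n) :
    heatKernel θ z ≤ (Real.pi * θ) ^ (-(n / 2 : ℝ)) := by
  refine mul_le_of_le_one_right (by positivity) (Real.exp_le_one_iff.2 ?_)
  rw [neg_div]
  exact neg_nonpos.2 (by positivity)

/-- Widening only increases the exponential factor, so the sole loss is the ratio of the
normalizations. This lets a kernel be replaced by one of diffusivity at least `ν`. -/
theorem heatKernel_le_of_le {n : ℕ} {θ θ' : ℝ} (hθ : 0 < θ) (h : θ ≤ θ') (z : Space n) :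
    heatKernel θ z ≤ (θ' / θ) ^ (n / 2 : ℝ) * heatKernel θ' z := by
  have hθ' := hθ.trans_le h
  have e : (Real.pi * θ) ^ (-(n / 2 : ℝ)) =
      (θ' / θ) ^ (n / 2 : ℝ) * (Real.pi * θ') ^ (-(n / 2 : ℝ)) := by
    rw [Real.rpow_neg (by positivity), Real.rpow_neg (by positivity),
      Real.div_rpow hθ'.le hθ.le, Real.mul_rpow Real.pi_pos.le hθ.le,
      Real.mul_rpow Real.pi_pos.le hθ'.le]
    have : 0 < θ ^ (n / 2 : ℝ) := by positivity
    have : 0 < θ' ^ (n / 2 : ℝ) := by positivity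
    have : 0 < Real.pi ^ (n / 2 : ℝ) := by positivity
    field_simp
  unfold heatKernel
  rw [e, mul_assoc]
  refine mul_le_mul_of_nonneg_left (mul_le_mul_of_nonneg_left (Real.exp_le_exp.2 ?_)
    (by positivity)) (by positivity)
  rw [neg_div, neg_div, neg_le_neg_iff]
  gcongr

/-- The semigroup property of the heat kernel. -/
theorem integral_heatKernel_mul_heatKernel {n : ℕ} {α β : ℝ} (hα : 0 < α) (hβ : 0 < β)
    (x₀ y : Space n) :
    ∫ x, heatKernel α (x - y) * heatKernel β (x₀ - x) = heatKernel (α + β) (x₀ - y) := by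
  have hs : 0 < α + β := by positivity
  -- Completing the square in `x`: the product is a constant times a Gaussian of parameter `α β / (α
  -- + β)` centred at the weighted mean of `y` and `x₀`.
  have e : ∀ x, heatKernel α (x - y) * heatKernel β (x₀ - x) = heatKernel (α + β) (x₀ - y) *
      heatKernel (α * β / (α + β)) ((y + (α / (α + β)) • (x₀ - y)) - x) := by
    intro x
    unfold heatKernel
    rw [mul_mul_mul_comm, mul_mul_mul_comm ((Real.pi * (α + β)) ^ (-(n / 2 : ℝ))), ← Real.exp_add,
      ← Real.exp_add, ← Real.mul_rpow (by positivity) (by positivity),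
      ← Real.mul_rpow (by positivity) (by positivity)]
    congr 2
    · field_simp
    · have h1 : x₀ - x = (x₀ - y) - (x - y) := by abel
      have h2 : y + (α / (α + β)) • (x₀ - y) - x = (α / (α + β)) • (x₀ - y) - (x - y) := by abel
      rw [h1, h2]
      generalize x₀ - y = q
      generalize x - y = p
      rw [norm_sub_sq_real, norm_sub_sq_real, norm_smul, inner_smul_left, Real.norm_of_nonneg
        (by positivity)]
      simp only [conj_trivial]
      field_simp
      ring
  simp_rw [e]
  rw [integral_const_mul, integral_heatKernel (by positivity), mul_one]

/-- Rescaling by `√(c s)` turns the kernel into a fixed probability density, and dominated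
convergence applies. -/
theorem tendsto_integral_mul_heatKernel {n : ℕ} {f : Space n → ℝ} (hf : Continuous f) {M : ℝ}
    (hM : ∀ y, |f y| ≤ M) (x : Space n) {c : ℝ} (hc : 0 < c) :
    Tendsto (fun s => ∫ y, f y * heatKernel (c * s) (x - y)) (𝓝[>] 0) (𝓝 (f x)) := by
  have key : ∀ s ∈ Ioi (0 : ℝ), ∫ y, f (x - Real.sqrt (c * s) • y) * heatKernel 1 y =
      ∫ y, f y * heatKernel (c * s) (x - y) := by
    intro s hs
    have hcs : 0 < c * s := mul_pos hc hs
    set r := Real.sqrt (c * s) with hr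
    have hr0 : 0 < r := Real.sqrt_pos.2 hcs
    have hr2 : c * s = r ^ 2 := (Real.sq_sqrt hcs.le).symm
    rw [← integral_sub_left_eq_self (fun y => f y * heatKernel (c * s) (x - y)) volume x]
    simp only [sub_sub_cancel]
    have h := Measure.integral_comp_smul (volume : Measure (Space n))
      (fun y => f (x - y) * heatKernel (c * s) y) r
    rw [finrank_euclideanSpace, Fintype.card_fin, abs_of_pos (by positivity), smul_eq_mul,
      eq_comm, inv_mul_eq_iff_eq_mul₀ (by positivity), ← integral_const_mul] at h
    rw [h]
    refine integral_congr_ae (Eventually.of_forall fun y => ?_)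
    simp only [heatKernel, hr2, norm_smul, Real.norm_of_nonneg hr0.le]
    have h1 : (Real.pi * r ^ 2) ^ (-(n / 2 : ℝ)) =
        (Real.pi * 1) ^ (-(n / 2 : ℝ)) * (r ^ n)⁻¹ := by
      rw [mul_one, Real.mul_rpow (by positivity) (by positivity), ← Real.rpow_natCast r 2,
        ← Real.rpow_mul hr0.le, ← Real.rpow_natCast r n, ← Real.rpow_neg hr0.le]
      congr 2
      push_cast
      ring
    rw [h1]
    field_simp
  have lim : Tendsto (fun s => ∫ y, f (x - Real.sqrt (c * s) • y) * heatKernel 1 y) (𝓝[>] 0)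
      (𝓝 (∫ y : Space n, f x * heatKernel 1 y)) := by
    refine tendsto_integral_filter_of_dominated_convergence (fun y => M * heatKernel 1 y)
      (Eventually.of_forall fun s => ?_) (Eventually.of_forall fun s =>
      Eventually.of_forall fun y => ?_) ?_ (Eventually.of_forall fun y => ?_)
    · refine Continuous.aestronglyMeasurable ?_
      have := continuous_heatKernel (n := n) 1
      fun_prop
    · rw [norm_mul, Real.norm_of_nonneg (heatKernel_pos one_pos y).le]
      exact mul_le_mul_of_nonneg_right (hM _) (heatKernel_pos one_pos y).le
    · simpa using ((integrable_heatKernel one_pos (0 : Space n)).comp_neg).const_mul M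
    · have h1 : Continuous fun s : ℝ => f (x - Real.sqrt (c * s) • y) * heatKernel 1 y := by
        fun_prop
      have h2 := h1.tendsto 0
      simp only [mul_zero, Real.sqrt_zero, zero_smul, sub_zero] at h2
      exact h2.mono_left nhdsWithin_le_nhds
  rw [integral_const_mul, integral_heatKernel_self one_pos, mul_one] at lim
  exact lim.congr' (eventually_mem_nhdsWithin.mono key)

/-- Convergence is only local in `L¹`. Outside a large ball the bound `M` meets a small Gaussian
tail; inside it the error is at most `sup G` times the `L¹` distance. Each contributes at most `K /
2`, whence `2K` instead of `K`. -/
theorem HasInitialData.eventually_integral_mul_heatKernel_le {n : ℕ} {w : ℝ → Space n → ℝ}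
    {w₀ : Space n → ℝ} (hw : HasInitialData w w₀) {K M T θ : ℝ} (hK : 0 < K) (hT : 0 < T)
    (hθ : 0 < θ) (hw₀ : ∀ x, w₀ x ≤ K) (hc : ∀ t, 0 < t → Continuous (w t))
    (h0 : ∀ t, 0 < t → ∀ x, 0 ≤ w t x) (hM : ∀ t, 0 < t → t ≤ T → ∀ x, w t x ≤ M) (x : Space n) :
    ∀ᶠ s in 𝓝[>] 0, ∫ y, w s y * heatKernel θ (x - y) ≤ 2 * K := by
  set H : ℝ := (Real.pi * θ) ^ (-(n / 2 : ℝ)) with hH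
  have H0 : 0 < H := by positivity
  have mk : Measurable (fun y => ENNReal.ofReal (heatKernel θ (x - y))) :=
    ((continuous_heatKernel θ).comp (by fun_prop : Continuous fun y => x - y)).measurable.ennreal_ofReal
  have one : ∫⁻ y, ENNReal.ofReal (heatKernel θ (x - y)) = 1 := by
    rw [← ofReal_integral_eq_lintegral_ofReal (integrable_heatKernel hθ x)
      (Eventually.of_forall fun y => (heatKernel_pos hθ _).le), integral_heatKernel hθ,
      ENNReal.ofReal_one]
  have tail : Tendsto (fun j : ℕ => ENNReal.ofReal M * ∫⁻ y, (Metric.ball (0 : Space n) j)ᶜ.indicator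
      (fun y => ENNReal.ofReal (heatKernel θ (x - y))) y) atTop (𝓝 0) := by
    have : Tendsto (fun j : ℕ => ∫⁻ y, (Metric.ball (0 : Space n) j)ᶜ.indicator
      (fun y => ENNReal.ofReal (heatKernel θ (x - y))) y) atTop (𝓝 (∫⁻ y : Space n, 0)) := by
      refine tendsto_lintegral_of_dominated_convergence _
        (fun j => mk.indicator Metric.isOpen_ball.measurableSet.compl)
        (fun j => Eventually.of_forall fun y => indicator_le_self _ _ _) (by rw [one]; simp)
        (Eventually.of_forall fun y => ?_)
      refine tendsto_const_nhds.congr' ?_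
      filter_upwards [eventually_gt_atTop ⌈‖y‖⌉₊] with j hj
      rw [indicator_of_notMem]
      simpa using (Nat.lt_of_ceil_lt hj)
    rw [lintegral_zero] at this
    simpa using ENNReal.Tendsto.const_mul this (Or.inr ENNReal.ofReal_ne_top)
  have hK2 : (0 : ℝ≥0∞) < ENNReal.ofReal (K / 2) := ENNReal.ofReal_pos.2 (by positivity)
  obtain ⟨j, hj⟩ := (tail.eventually (gt_mem_nhds hK2)).exists
  have near : Tendsto (fun s => ENNReal.ofReal H * ∫⁻ y in Metric.ball (0 : Space n) j,
      ‖w s y - w₀ y‖ₑ) (𝓝[>] 0) (𝓝 0) := by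
    simpa using ENNReal.Tendsto.const_mul (hw j) (Or.inr ENNReal.ofReal_ne_top)
  filter_upwards [near.eventually (gt_mem_nhds hK2), self_mem_nhdsWithin,
    mem_nhdsWithin_of_mem_nhds (gt_mem_nhds hT)] with s hs hs0 hsT
  have hs0 : 0 < s := hs0
  have I : Integrable (fun y => w s y * heatKernel θ (x - y)) :=
    integrable_mul_heatKernel hθ x (hc s hs0) (M := M) fun y => by
      rw [abs_of_nonneg (h0 s hs0 y)]
      exact hM s hs0 (le_of_lt hsT) y
  rw [← ENNReal.ofReal_le_ofReal_iff (by positivity), ofReal_integral_eq_lintegral_ofReal I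
    (Eventually.of_forall fun y => mul_nonneg (h0 s hs0 y) (heatKernel_pos hθ _).le)]
  have pt : ∀ y, ENNReal.ofReal (w s y * heatKernel θ (x - y)) ≤
      ENNReal.ofReal K * ENNReal.ofReal (heatKernel θ (x - y)) +
      ENNReal.ofReal M * (Metric.ball (0 : Space n) j)ᶜ.indicator
        (fun y => ENNReal.ofReal (heatKernel θ (x - y))) y +
      ENNReal.ofReal H * (Metric.ball (0 : Space n) j).indicator (fun y => ‖w s y - w₀ y‖ₑ) y := by
    intro y
    have k0 := (heatKernel_pos hθ (x - y)).le
    by_cases hy : y ∈ Metric.ball (0 : Space n) j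
    · rw [indicator_of_notMem (by simpa using hy), indicator_of_mem hy, mul_zero, add_zero,
        ← ENNReal.ofReal_mul hK.le, ← ofReal_norm, ← ENNReal.ofReal_mul H0.le,
        ← ENNReal.ofReal_add (by positivity) (by positivity)]
      apply ENNReal.ofReal_le_ofReal
      have h1 : w s y ≤ K + ‖w s y - w₀ y‖ := by
        have := le_abs_self (w s y - w₀ y)
        rw [← Real.norm_eq_abs] at this
        linarith [hw₀ y]
      calc w s y * heatKernel θ (x - y) ≤ (K + ‖w s y - w₀ y‖) * heatKernel θ (x - y) := by gcongr
        _ = K * heatKernel θ (x - y) + heatKernel θ (x - y) * ‖w s y - w₀ y‖ := by ring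
        _ ≤ _ := by gcongr; exact heatKernel_le hθ _
    · rw [indicator_of_mem (by simpa using hy : y ∈ (Metric.ball (0 : Space n) j)ᶜ)]
      refine le_trans ?_ (le_add_right le_add_self)
      rw [ENNReal.ofReal_mul (h0 s hs0 y)]
      gcongr
      exact hM s hs0 (le_of_lt hsT) y
  refine (lintegral_mono pt).trans ?_
  rw [lintegral_add_left, lintegral_add_left (mk.const_mul _), lintegral_const_mul _ mk, one,
    lintegral_const_mul _ (mk.indicator Metric.isOpen_ball.measurableSet.compl),
    lintegral_const_mul' _ _ ENNReal.ofReal_ne_top, lintegral_indicator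
    Metric.isOpen_ball.measurableSet, mul_one]
  · calc _ ≤ ENNReal.ofReal K + ENNReal.ofReal (K / 2) + ENNReal.ofReal (K / 2) := by gcongr
      _ = _ := by
        rw [← ENNReal.ofReal_add (by positivity) (by positivity),
          ← ENNReal.ofReal_add (by positivity) (by positivity)]
        congr 1
        ring
  · exact (mk.const_mul _).add ((mk.indicator Metric.isOpen_ball.measurableSet.compl).const_mul _)

/-! ### Testing against backward heat kernels -/

/-- Testing a forced heat equation with diffusivity `a` against the heat kernel with diffusivity
`D`, weighted by a function of time. -/
theorem heatKernel_identity {n : ℕ} {a D σ t₁ t₂ T M : ℝ} {w F : ℝ → Space n → ℝ} {η η' : ℝ → ℝ}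
    (hw : IsClassOneTwo w) (ht₁ : 0 < t₁) (ht : t₁ ≤ t₂) (hT : t₂ < T) (hD : 0 < D) (hσ : σ ≠ 0)
    (heq : ∀ t ∈ Icc t₁ t₂, ∀ x,
      deriv (fun s => w s x) t = a * Laplacian.laplacian (w t) x + σ * F t x)
    (hM : ∀ t ∈ Icc t₁ t₂, ∀ x, |w t x| ≤ M) (hF : ∀ t ∈ Icc t₁ t₂, ∀ x, 0 ≤ F t x)
    (hη : ∀ s ∈ Icc t₁ t₂, HasDerivAt η (η' s) s) (hη' : ContinuousOn η' (Icc t₁ t₂))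
    (hη0 : ∀ s ∈ Icc t₁ t₂, 0 ≤ η s) (x : Space n) :
    Integrable (fun p : ℝ × Space n =>
      F p.1 p.2 * (η p.1 * heatKernel (4 * D * (T - p.1)) (x - p.2))) (slabMeasure n t₁ t₂) ∧
    (∫ y, w t₂ y * (η t₂ * heatKernel (4 * D * (T - t₂)) (x - y))) -
      ∫ y, w t₁ y * (η t₁ * heatKernel (4 * D * (T - t₁)) (x - y)) =
    (∫ p, w p.1 p.2 * ((η' p.1 + 4 * (a - D) * η p.1 * (‖x - p.2‖ ^ 2 / (4 * D * (T - p.1)) ^ 2 -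
      n / (2 * (4 * D * (T - p.1))))) * heatKernel (4 * D * (T - p.1)) (x - p.2))
      ∂slabMeasure n t₁ t₂) +
    σ * ∫ p, F p.1 p.2 * (η p.1 * heatKernel (4 * D * (T - p.1)) (x - p.2))
      ∂slabMeasure n t₁ t₂ := by
  have hθ : ∀ s ∈ Icc t₁ t₂, 0 < 4 * D * (T - s) := fun s hs => by
    have := hs.2
    have : 0 < T - s := by linarith
    positivity
  have dθ : ∀ s, HasDerivAt (fun s => 4 * D * (T - s)) (-(4 * D)) s := fun s => by
    simpa using ((hasDerivAt_id s).const_sub T).const_mul (4 * D)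
  have cθ : Continuous fun s => 4 * D * (T - s) := by fun_prop
  have cη : ContinuousOn η (Icc t₁ t₂) := fun s hs => (hη s hs).continuousAt.continuousWithinAt
  have cP : ContinuousOn (fun s => (Real.pi * (4 * D * (T - s))) ^ (-(n / 2 : ℝ))) (Icc t₁ t₂) :=
    ContinuousOn.rpow_const (by fun_prop)
      fun s hs => Or.inl (mul_pos Real.pi_pos (hθ s hs)).ne'
  -- With `θ = 4D(T - s)`, the test function is the Gaussian with `A = η (πθ)^(-n/2)` and `b = 1 /
  -- θ`; `b` increases with `s`, so `b₀` is its value at `t₁`. As the kernel is annihilated by `∂ₛ +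
  -- DΔ`, only `η'` and the `(a - D)Δ` term survive.
  have main := gaussian_identity (b₀ := 1 / (4 * D * (T - t₁))) hw ht₁ ht hσ heq hM hF
    (A := fun s => η s * (Real.pi * (4 * D * (T - s))) ^ (-(n / 2 : ℝ)))
    (A' := fun s => (Real.pi * (4 * D * (T - s))) ^ (-(n / 2 : ℝ)) *
      (η' s + η s * (2 * n * D / (4 * D * (T - s)))))
    (b := fun s => 1 / (4 * D * (T - s))) (b' := fun s => 4 * D / (4 * D * (T - s)) ^ 2)
    (fun s hs => by
      have h1 := hθ s hs
      have h2 := ((dθ s).const_mul Real.pi).rpow_const (p := -(n / 2 : ℝ))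
        (Or.inl (mul_pos Real.pi_pos h1).ne')
      refine ((hη s hs).mul h2).congr_deriv ?_
      rw [Real.rpow_sub_one (mul_pos Real.pi_pos h1).ne']
      have h3 : 0 < T - s := by linarith [hs.2]
      field_simp
      ring)
    (fun s hs => by
      have h1 := hθ s hs
      have := (dθ s).fun_inv h1.ne'
      simp only [one_div]
      refine this.congr_deriv ?_
      ring)
    (by
      refine cP.mul (hη'.add (cη.mul (ContinuousOn.div (by fun_prop) (by fun_prop) ?_)))
      exact fun s hs => (hθ s hs).ne')
    (ContinuousOn.div (by fun_prop) (by fun_prop) fun s hs => (pow_pos (hθ s hs) 2).ne')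
    (fun s hs => mul_nonneg (hη0 s hs) (Real.rpow_nonneg
      (mul_pos Real.pi_pos (hθ s hs)).le _))
    (by have := hθ t₁ ⟨le_rfl, ht⟩; positivity)
    (fun s hs => one_div_le_one_div_of_le (hθ s hs) (by have := hs.1; gcongr)) x
  simp_rw [heatKernel_eq_gaussCut]
  refine ⟨main.1, main.2.trans ?_⟩
  congr 1
  refine integral_congr_ae (ae_slabMeasure fun s hs y => ?_)
  have h1 := hθ s hs
  have h3 : 0 < T - s := by linarith [hs.2]
  simp only [backwardHeatGaussCut, gaussCut]
  simp
  field_simp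
  ring_nf
  exact Or.inl trivial


theorem continuousOn_heatKernel_slab {n : ℕ} {D T t₁ t₂ : ℝ} (hD : 0 < D) (hT : t₂ < T)
    (x : Space n) : ContinuousOn (fun p : ℝ × Space n => heatKernel (4 * D * (T - p.1)) (x - p.2))
      (Icc t₁ t₂ ×ˢ univ) := by
  have hθ : ∀ p ∈ (Icc t₁ t₂ ×ˢ univ : Set (ℝ × Space n)), 0 < 4 * D * (T - p.1) := fun p hp => by
    have : 0 < T - p.1 := by linarith [hp.1.2]
    positivity
  unfold heatKernel
  refine ContinuousOn.mul (ContinuousOn.rpow_const (by fun_prop)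
    fun p hp => Or.inl (mul_pos Real.pi_pos (hθ p hp)).ne') (ContinuousOn.rexp ?_)
  exact ContinuousOn.div (by fun_prop) (by fun_prop) fun p hp => (hθ p hp).ne'

theorem integrable_slab_mul_heatKernel {n : ℕ} {D T t₁ t₂ : ℝ} (hD : 0 < D) (hT : t₂ < T)
    {f : ℝ → ℝ} (hf : ContinuousOn f (Icc t₁ t₂)) (x : Space n) :
    Integrable (fun p : ℝ × Space n => f p.1 * heatKernel (4 * D * (T - p.1)) (x - p.2))
      (slabMeasure n t₁ t₂) ∧
    ∫ p : ℝ × Space n, f p.1 * heatKernel (4 * D * (T - p.1)) (x - p.2) ∂slabMeasure n t₁ t₂ =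
      ∫ s in Ioc t₁ t₂, f s := by
  have hθ : ∀ s ∈ Ioc t₁ t₂, 0 < 4 * D * (T - s) := fun s hs => by
    have : 0 < T - s := by linarith [hs.2]
    positivity
  have hm : AEStronglyMeasurable (fun p : ℝ × Space n =>
      f p.1 * heatKernel (4 * D * (T - p.1)) (x - p.2)) (slabMeasure n t₁ t₂) :=
    aestronglyMeasurable_slabMeasure ((hf.comp continuousOn_fst fun p hp => hp.1).mul
      (continuousOn_heatKernel_slab hD hT x))
  have hfi : IntegrableOn f (Ioc t₁ t₂) :=
    (hf.integrableOn_compact isCompact_Icc).mono_set Ioc_subset_Icc_self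
  have hI : Integrable (fun p : ℝ × Space n => f p.1 * heatKernel (4 * D * (T - p.1)) (x - p.2))
      (slabMeasure n t₁ t₂) := by
    rw [integrable_prod_iff hm]
    constructor
    · filter_upwards [ae_restrict_mem measurableSet_Ioc] with s hs
      exact (integrable_heatKernel (hθ s hs) x).const_mul _
    · refine hfi.norm.congr ?_
      filter_upwards [ae_restrict_mem measurableSet_Ioc] with s hs
      simp only [norm_mul, Real.norm_of_nonneg (heatKernel_pos (hθ s hs) _).le]
      rw [integral_const_mul, integral_heatKernel (hθ s hs), mul_one]
  refine ⟨hI, ?_⟩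
  rw [integral_prod _ hI]
  refine setIntegral_congr_fun measurableSet_Ioc fun s hs => ?_
  simp only
  rw [integral_const_mul, integral_heatKernel (hθ s hs), mul_one]

/-- Testing a forced heat equation against its own backward heat kernel. -/
theorem heatKernel_identity_self {n : ℕ} {a σ t₁ t₂ T M : ℝ} {w F : ℝ → Space n → ℝ}
    (hw : IsClassOneTwo w) (ht₁ : 0 < t₁) (ht : t₁ ≤ t₂) (hT : t₂ < T) (ha : 0 < a) (hσ : σ ≠ 0)
    (heq : ∀ t ∈ Icc t₁ t₂, ∀ x,
      deriv (fun s => w s x) t = a * Laplacian.laplacian (w t) x + σ * F t x)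
    (hM : ∀ t ∈ Icc t₁ t₂, ∀ x, |w t x| ≤ M) (hF : ∀ t ∈ Icc t₁ t₂, ∀ x, 0 ≤ F t x)
    (x : Space n) :
    Integrable (fun p : ℝ × Space n =>
      F p.1 p.2 * heatKernel (4 * a * (T - p.1)) (x - p.2)) (slabMeasure n t₁ t₂) ∧
    (∫ y, w t₂ y * heatKernel (4 * a * (T - t₂)) (x - y)) -
      ∫ y, w t₁ y * heatKernel (4 * a * (T - t₁)) (x - y) =
    σ * ∫ p, F p.1 p.2 * heatKernel (4 * a * (T - p.1)) (x - p.2) ∂slabMeasure n t₁ t₂ := by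
  have h := heatKernel_identity (η := fun _ => 1) (η' := fun _ => 0) hw ht₁ ht hT ha hσ heq hM hF
    (fun s _ => hasDerivAt_const s 1) continuousOn_const (fun _ _ => zero_le_one) x
  simpa using h

/-! ### Bounds on the reaction that do not see `g` -/

namespace IsThermoDiffusiveSolution

variable {n : ℕ} {K κ ν : ℝ} {g : ℝ → ℝ} {u₀ v₀ : Space n → ℝ} {u v : ℝ → Space n → ℝ}

theorem exists_abs_le (h : IsThermoDiffusiveSolution ν κ g u₀ v₀ u v) (T : ℝ) :
    ∃ M : ℝ, ∀ t, 0 < t → t ≤ T → ∀ x, |u t x| ≤ M ∧ |v t x| ≤ M := by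
  obtain ⟨M, hM⟩ := h.bounded T
  refine ⟨M, fun t h0 hT x => ?_⟩
  rw [abs_of_nonneg (h.nonneg_u t h0 x), abs_of_nonneg (h.nonneg_v t h0 x)]
  exact hM t h0 hT x

theorem reaction_nonneg (h : IsThermoDiffusiveSolution ν κ g u₀ v₀ u v)
    (hg : ∀ r, 0 ≤ r → 0 ≤ g r) {t : ℝ} (ht : 0 < t) (x : Space n) : 0 ≤ u t x * g (v t x) :=
  mul_nonneg (h.nonneg_u t ht x) (hg _ (h.nonneg_v t ht x))

theorem identity_v (h : IsThermoDiffusiveSolution ν κ g u₀ v₀ u v)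
    (hg : ∀ r, 0 ≤ r → 0 ≤ g r) (hκ : 0 < κ) {t₁ t₂ T : ℝ} (ht₁ : 0 < t₁) (ht : t₁ ≤ t₂)
    (hT : t₂ < T) (x : Space n) :
    Integrable (fun p : ℝ × Space n => (u p.1 p.2 * g (v p.1 p.2)) *
      heatKernel (4 * κ * (T - p.1)) (x - p.2)) (slabMeasure n t₁ t₂) ∧
    (∫ y, v t₂ y * heatKernel (4 * κ * (T - t₂)) (x - y)) -
      ∫ y, v t₁ y * heatKernel (4 * κ * (T - t₁)) (x - y) =
    ∫ p, (u p.1 p.2 * g (v p.1 p.2)) * heatKernel (4 * κ * (T - p.1)) (x - p.2)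
      ∂slabMeasure n t₁ t₂ := by
  obtain ⟨M, hM⟩ := h.exists_abs_le t₂
  have := heatKernel_identity_self (σ := 1) (F := fun t x => u t x * g (v t x)) (M := M)
    h.regular_v ht₁ ht hT hκ one_ne_zero
    (fun t hs x => by rw [h.equation_v t (ht₁.trans_le hs.1) x, one_mul])
    (fun t hs x => (hM t (ht₁.trans_le hs.1) hs.2 x).2)
    (fun t hs x => h.reaction_nonneg hg (ht₁.trans_le hs.1) x) x
  rwa [one_mul] at this

/-- Maximum principle: the reaction only consumes `u`, so `u` lies below the caloric evolution of
its data. -/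
theorem u_le (h : IsThermoDiffusiveSolution ν κ g u₀ v₀ u v)
    (hg : ∀ r, 0 ≤ r → 0 ≤ g r) (hν : 0 < ν) (hK : 0 < K) (hu₀ : ∀ x, u₀ x ≤ K)
    {t : ℝ} (ht : 0 < t) (x : Space n) : u t x ≤ 2 * K := by
  obtain ⟨M, hM⟩ := h.exists_abs_le t
  have hc : ∀ t, 0 < t → Continuous (u t) := fun t ht => (h.regular_u.contDiff_space t ht).continuous
  have lim := tendsto_integral_mul_heatKernel (hc t ht) (fun y => (hM t ht le_rfl y).1) x
    (c := 4 * ν) (by positivity)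
  have ini := h.initial_u.eventually_integral_mul_heatKernel_le hK ht
    (θ := 4 * ν * t) (by positivity) hu₀ hc h.nonneg_u
    (fun s hs hst y => (le_abs_self _).trans (hM s hs hst y).1) x
  refine le_of_tendsto lim ?_
  filter_upwards [ini, self_mem_nhdsWithin, mem_nhdsWithin_of_mem_nhds (gt_mem_nhds ht)]
    with s h1 hs hst
  have hs : 0 < s := hs
  -- With the pole at `t + s`, the kernel at time `s` has the fixed parameter `4νt`, while at time
  -- `t` it has parameter `4νs` and concentrates as `s → 0`.
  have id := (heatKernel_identity_self (σ := -1) (F := fun t x => u t x * g (v t x)) (M := M)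
    (T := t + s) h.regular_u hs (le_of_lt hst) (by linarith) hν (by norm_num)
    (fun r hr x => by rw [h.equation_u r (hs.trans_le hr.1) x]; ring)
    (fun r hr x => (hM r (hs.trans_le hr.1) hr.2 x).1)
    (fun r hr x => h.reaction_nonneg hg (hs.trans_le hr.1) x) x).2
  rw [add_sub_cancel_left, add_sub_cancel_right] at id
  have pos : 0 ≤ ∫ p : ℝ × Space n, (u p.1 p.2 * g (v p.1 p.2)) *
      heatKernel (4 * ν * (t + s - p.1)) (x - p.2) ∂slabMeasure n s t := by
    refine integral_nonneg_of_ae (ae_slabMeasure fun r hr y => ?_)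
    have : 0 < t + s - r := by linarith [hr.2]
    exact mul_nonneg (h.reaction_nonneg hg (hs.trans_le hr.1) y)
      (heatKernel_pos (by positivity) _).le
  linarith

/-- The reaction consumes `u`, and there is at most `2K` of it to consume. For `D ≥ ν` the quadratic
term of `(∂ₛ + νΔ)(ηG)` has a favourable sign, and the remaining coefficient is at most `η' + nη /
(2(T - s)) ≤ ζ'`. Since `G` has mass 1, integrating `ζ'` leaves the increment of `ζ`. -/
theorem integral_reaction_mul_le (h : IsThermoDiffusiveSolution ν κ g u₀ v₀ u v)
    (hg : ∀ r, 0 ≤ r → 0 ≤ g r) (hν : 0 < ν) (hK : 0 < K) (hu₀ : ∀ x, u₀ x ≤ K)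
    {D t₁ t₂ T : ℝ} (hD : ν ≤ D) (ht₁ : 0 < t₁) (ht : t₁ ≤ t₂) (hT : t₂ < T)
    {η η' ζ ζ' : ℝ → ℝ}
    (hη : ∀ s ∈ Icc t₁ t₂, HasDerivAt η (η' s) s) (hη' : ContinuousOn η' (Icc t₁ t₂))
    (hη0 : ∀ s ∈ Icc t₁ t₂, 0 ≤ η s)
    (hζ : ∀ s ∈ Icc t₁ t₂, HasDerivAt ζ (ζ' s) s) (hζ' : ContinuousOn ζ' (Icc t₁ t₂))
    (hζ0 : ∀ s ∈ Icc t₁ t₂, 0 ≤ ζ' s)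
    (hηζ : ∀ s ∈ Icc t₁ t₂, η' s + n * η s / (2 * (T - s)) ≤ ζ' s) (x : Space n) :
    Integrable (fun p : ℝ × Space n => (u p.1 p.2 * g (v p.1 p.2)) *
      (η p.1 * heatKernel (4 * D * (T - p.1)) (x - p.2))) (slabMeasure n t₁ t₂) ∧
    ∫ p : ℝ × Space n, (u p.1 p.2 * g (v p.1 p.2)) *
      (η p.1 * heatKernel (4 * D * (T - p.1)) (x - p.2)) ∂slabMeasure n t₁ t₂ ≤
      2 * K * (η t₁ + (ζ t₂ - ζ t₁)) := by
  have hD0 : 0 < D := hν.trans_le hD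
  have hθ : ∀ s ∈ Icc t₁ t₂, 0 < 4 * D * (T - s) := fun s hs => by
    have : 0 < T - s := by linarith [hs.2]
    positivity
  have hul : ∀ s ∈ Icc t₁ t₂, ∀ y, u s y ≤ 2 * K := fun s hs y =>
    h.u_le hg hν hK hu₀ (ht₁.trans_le hs.1) y
  have hu0 : ∀ s ∈ Icc t₁ t₂, ∀ y, 0 ≤ u s y := fun s hs y =>
    h.nonneg_u s (ht₁.trans_le hs.1) y
  obtain ⟨I, id⟩ := heatKernel_identity (σ := -1) (F := fun t x => u t x * g (v t x)) (M := 2 * K)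
    h.regular_u ht₁ ht hT hD0 (by norm_num)
    (fun r hr x => by rw [h.equation_u r (ht₁.trans_le hr.1) x]; ring)
    (fun r hr x => by rw [abs_of_nonneg (hu0 r hr x)]; exact hul r hr x)
    (fun r hr x => h.reaction_nonneg hg (ht₁.trans_le hr.1) x) hη hη' hη0 x
  refine ⟨I, ?_⟩
  have e2 : 0 ≤ ∫ y, u t₂ y * (η t₂ * heatKernel (4 * D * (T - t₂)) (x - y)) := by
    have ht₂ : t₂ ∈ Icc t₁ t₂ := ⟨ht, le_rfl⟩
    exact integral_nonneg fun y => mul_nonneg (hu0 _ ht₂ _)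
      (mul_nonneg (hη0 _ ht₂) (heatKernel_pos (hθ _ ht₂) _).le)
  have e1 : ∫ y, u t₁ y * (η t₁ * heatKernel (4 * D * (T - t₁)) (x - y)) ≤ 2 * K * η t₁ := by
    have ht₂ : t₁ ∈ Icc t₁ t₂ := ⟨le_rfl, ht⟩
    calc _ ≤ ∫ y, 2 * K * η t₁ * heatKernel (4 * D * (T - t₁)) (x - y) := by
          refine integral_mono_of_nonneg (Eventually.of_forall fun y => mul_nonneg (hu0 _ ht₂ _)
            (mul_nonneg (hη0 _ ht₂) (heatKernel_pos (hθ _ ht₂) _).le))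
            ((integrable_heatKernel (hθ _ ht₂) x).const_mul _) (Eventually.of_forall fun y => ?_)
          simp only
          rw [mul_assoc (2 * K)]
          exact mul_le_mul_of_nonneg_right (hul _ ht₂ y)
            (mul_nonneg (hη0 _ ht₂) (heatKernel_pos (hθ _ ht₂) _).le)
      _ = _ := by rw [integral_const_mul, integral_heatKernel (hθ _ ht₂), mul_one]
  obtain ⟨J, eJ⟩ := integrable_slab_mul_heatKernel hD0 hT (f := fun s => (2 * K) • ζ' s)
    (hζ'.const_smul (2 * K)) x
  have ftc : ∫ s in Ioc t₁ t₂, (2 * K) • ζ' s = 2 * K * (ζ t₂ - ζ t₁) := by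
    simp only [smul_eq_mul]
    rw [integral_const_mul, ← intervalIntegral.integral_of_le ht,
      intervalIntegral.integral_eq_sub_of_hasDerivAt (f := ζ)
      (by rwa [uIcc_of_le ht]) (ContinuousOn.intervalIntegrable (by rwa [uIcc_of_le ht]))]
  have e3 : ∫ p : ℝ × Space n, u p.1 p.2 * ((η' p.1 + 4 * (ν - D) * η p.1 *
      (‖x - p.2‖ ^ 2 / (4 * D * (T - p.1)) ^ 2 - n / (2 * (4 * D * (T - p.1))))) *
      heatKernel (4 * D * (T - p.1)) (x - p.2)) ∂slabMeasure n t₁ t₂ ≤ 2 * K * (ζ t₂ - ζ t₁) := by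
    rw [← ftc, ← eJ]
    have nonneg : ∀ s ∈ Icc t₁ t₂, ∀ y : Space n,
        0 ≤ ((2 * K) • ζ' s) * heatKernel (4 * D * (T - s)) (x - y) := fun s hs y =>
      mul_nonneg (mul_nonneg (by positivity) (hζ0 s hs)) (heatKernel_pos (hθ s hs) _).le
    by_cases hI : Integrable (fun p : ℝ × Space n => u p.1 p.2 * ((η' p.1 + 4 * (ν - D) * η p.1 *
      (‖x - p.2‖ ^ 2 / (4 * D * (T - p.1)) ^ 2 - n / (2 * (4 * D * (T - p.1))))) *
      heatKernel (4 * D * (T - p.1)) (x - p.2))) (slabMeasure n t₁ t₂)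
    · refine integral_mono_ae hI J (ae_slabMeasure fun s hs y => ?_)
      simp only [smul_eq_mul]
      have k0 := (heatKernel_pos (hθ s hs) (x - y)).le
      have hTs : 0 < T - s := by linarith [hs.2]
      have b1 : η' s + 4 * (ν - D) * η s * (‖x - y‖ ^ 2 / (4 * D * (T - s)) ^ 2 -
          n / (2 * (4 * D * (T - s)))) ≤ ζ' s := by
        refine le_trans ?_ (hηζ s hs)
        have e : 4 * (ν - D) * η s * (‖x - y‖ ^ 2 / (4 * D * (T - s)) ^ 2 -
          n / (2 * (4 * D * (T - s)))) = n * η s / (2 * (T - s)) - (4 * (D - ν) * η s *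
          (‖x - y‖ ^ 2 / (4 * D * (T - s)) ^ 2) + 4 * ν * η s * (n / (2 * (4 * D * (T - s))))) := by
          field_simp
          ring
        have hDν : 0 ≤ D - ν := by linarith
        have := hη0 s hs
        have p1 : 0 ≤ 4 * (D - ν) * η s * (‖x - y‖ ^ 2 / (4 * D * (T - s)) ^ 2) := by positivity
        have p2 : 0 ≤ 4 * ν * η s * (n / (2 * (4 * D * (T - s)))) := by positivity
        rw [e]
        linarith
      rw [mul_assoc (2 * K)]
      exact (mul_le_mul_of_nonneg_left (mul_le_mul_of_nonneg_right b1 k0) (hu0 s hs y)).trans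
        (mul_le_mul_of_nonneg_right (hul s hs y) (mul_nonneg (hζ0 s hs) k0))
    -- If the integrand is not integrable, its Bochner integral is 0, and the claimed bound is
    -- nonnegative.
    · rw [integral_undef hI]
      exact integral_nonneg_of_ae (ae_slabMeasure nonneg)
  linarith

/-- The weight `η = (T - s)^(n/2)` solves `η' + nη / (2(T - s)) = 0`, so `ζ = 0` suffices.
Diffusivity `κ + ν` exceeds `ν` and its kernel dominates the `κ`-kernel up to `((κ + ν) / κ)^(n/2)`;
the weight is removed by its minimum, at `t₂`. -/
theorem integral_reaction_mul_heatKernel_le (h : IsThermoDiffusiveSolution ν κ g u₀ v₀ u v)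
    (hg : ∀ r, 0 ≤ r → 0 ≤ g r) (hν : 0 < ν) (hκ : 0 < κ) (hK : 0 < K) (hu₀ : ∀ x, u₀ x ≤ K)
    {t₁ t₂ T : ℝ} (ht₁ : 0 < t₁) (ht : t₁ ≤ t₂) (hT : t₂ < T) (x : Space n) :
    ∫ p : ℝ × Space n, (u p.1 p.2 * g (v p.1 p.2)) * heatKernel (4 * κ * (T - p.1)) (x - p.2)
      ∂slabMeasure n t₁ t₂ ≤
      2 * K * ((κ + ν) / κ) ^ (n / 2 : ℝ) * ((T - t₁) / (T - t₂)) ^ (n / 2 : ℝ) := by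
  have hpos : ∀ s ∈ Icc t₁ t₂, 0 < T - s := fun s hs => by linarith [hs.2]
  have h2 : 0 < T - t₂ := by linarith
  have h1 : 0 < T - t₁ := by linarith
  obtain ⟨I, hI⟩ := h.integral_reaction_mul_le hg hν hK hu₀ (D := κ + ν) (by linarith) ht₁ ht hT
    (η := fun s => (T - s) ^ (n / 2 : ℝ))
    (η' := fun s => -1 * (n / 2 : ℝ) * (T - s) ^ (n / 2 - 1 : ℝ)) (ζ := fun _ => 0)
    (ζ' := fun _ => 0)
    (fun s hs => ((hasDerivAt_id s).const_sub T).rpow_const (Or.inl (hpos s hs).ne'))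
    (by
      refine continuousOn_const.mul (ContinuousOn.rpow_const (by fun_prop)
        fun s hs => Or.inl (hpos s hs).ne'))
    (fun s hs => Real.rpow_nonneg (hpos s hs).le _)
    (fun s _ => hasDerivAt_const s 0) continuousOn_const (fun _ _ => le_rfl)
    (fun s hs => by
      rw [Real.rpow_sub_one (hpos s hs).ne']
      apply le_of_eq
      have := hpos s hs
      field_simp
      ring) x
  set c := ((κ + ν) / κ) ^ (n / 2 : ℝ) * ((T - t₂) ^ (n / 2 : ℝ))⁻¹ with hc
  have hc0 : 0 ≤ c := by positivity
  calc _ ≤ ∫ p : ℝ × Space n, c * ((u p.1 p.2 * g (v p.1 p.2)) *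
      ((T - p.1) ^ (n / 2 : ℝ) * heatKernel (4 * (κ + ν) * (T - p.1)) (x - p.2)))
      ∂slabMeasure n t₁ t₂ := by
        refine integral_mono_of_nonneg (ae_slabMeasure fun s hs y => ?_) (I.const_mul c)
          (ae_slabMeasure fun s hs y => ?_)
        · have := hpos s hs
          exact mul_nonneg (h.reaction_nonneg hg (ht₁.trans_le hs.1) y)
            (heatKernel_pos (by positivity) _).le
        · have hs' := hpos s hs
          have k0 := (heatKernel_pos (show 0 < 4 * (κ + ν) * (T - s) by positivity) (x - y)).le
          have b1 := heatKernel_le_of_le (θ := 4 * κ * (T - s)) (θ' := 4 * (κ + ν) * (T - s))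
            (by positivity) (by gcongr; linarith) (x - y)
          have e1 : 4 * (κ + ν) * (T - s) / (4 * κ * (T - s)) = (κ + ν) / κ := by field_simp
          rw [e1] at b1
          have b2 : 1 ≤ ((T - t₂) ^ (n / 2 : ℝ))⁻¹ * (T - s) ^ (n / 2 : ℝ) := by
            rw [inv_mul_eq_div, one_le_div (by positivity)]
            exact Real.rpow_le_rpow h2.le (by linarith [hs.2]) (by positivity)
          have F0 := h.reaction_nonneg hg (ht₁.trans_le hs.1) y
          calc (u s y * g (v s y)) * heatKernel (4 * κ * (T - s)) (x - y)
              ≤ (u s y * g (v s y)) * (((κ + ν) / κ) ^ (n / 2 : ℝ) *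
                heatKernel (4 * (κ + ν) * (T - s)) (x - y)) * 1 := by
                rw [mul_one]; gcongr
            _ ≤ (u s y * g (v s y)) * (((κ + ν) / κ) ^ (n / 2 : ℝ) *
                heatKernel (4 * (κ + ν) * (T - s)) (x - y)) *
                (((T - t₂) ^ (n / 2 : ℝ))⁻¹ * (T - s) ^ (n / 2 : ℝ)) := by gcongr
            _ = _ := by simp only [hc]; ring
    _ ≤ c * (2 * K * ((T - t₁) ^ (n / 2 : ℝ) + (0 - 0))) := by
        rw [integral_const_mul]
        gcongr
    _ = _ := by
        rw [Real.div_rpow h1.le h2.le, hc]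
        ring

/-- For `η = (T - s)^(-1/2)` one has `η' + nη / (2(T - s)) = (n + 1) η'`, so `ζ = (n + 1) η`. The
bound depends on `t₂` but not on `t₁`, so the whole past can be included. -/
theorem integral_reaction_mul_rpow_heatKernel_le (h : IsThermoDiffusiveSolution ν κ g u₀ v₀ u v)
    (hg : ∀ r, 0 ≤ r → 0 ≤ g r) (hν : 0 < ν) (hK : 0 < K) (hu₀ : ∀ x, u₀ x ≤ K)
    {D t₁ t₂ T : ℝ} (hD : ν ≤ D) (ht₁ : 0 < t₁) (ht : t₁ ≤ t₂) (hT : t₂ < T) (x : Space n) :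
    Integrable (fun p : ℝ × Space n => (u p.1 p.2 * g (v p.1 p.2)) *
      ((T - p.1) ^ (-(1 / 2) : ℝ) * heatKernel (4 * D * (T - p.1)) (x - p.2)))
      (slabMeasure n t₁ t₂) ∧
    ∫ p : ℝ × Space n, (u p.1 p.2 * g (v p.1 p.2)) *
      ((T - p.1) ^ (-(1 / 2) : ℝ) * heatKernel (4 * D * (T - p.1)) (x - p.2))
      ∂slabMeasure n t₁ t₂ ≤ 2 * K * ((n + 1) * (T - t₂) ^ (-(1 / 2) : ℝ)) := by
  have hpos : ∀ s ∈ Icc t₁ t₂, 0 < T - s := fun s hs => by linarith [hs.2]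
  have d : ∀ s ∈ Icc t₁ t₂, HasDerivAt (fun s => (T - s) ^ (-(1 / 2) : ℝ))
      (1 / 2 * (T - s) ^ (-(1 / 2) - 1 : ℝ)) s := fun s hs =>
    (((hasDerivAt_id s).const_sub T).rpow_const (Or.inl (hpos s hs).ne')).congr_deriv (by
      simp only [id]
      ring)
  have c : ContinuousOn (fun s => (1 / 2 * (T - s) ^ (-(1 / 2) - 1 : ℝ))) (Icc t₁ t₂) :=
    continuousOn_const.mul (ContinuousOn.rpow_const (by fun_prop)
      fun s hs => Or.inl (hpos s hs).ne')
  obtain ⟨I, hI⟩ := h.integral_reaction_mul_le hg hν hK hu₀ hD ht₁ ht hT d c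
    (fun s hs => Real.rpow_nonneg (hpos s hs).le _)
    (fun s hs => (d s hs).const_mul (n + 1 : ℝ)) (c.const_smul (n + 1 : ℝ))
    (fun s hs => by have := hpos s hs; positivity)
    (fun s hs => by
      rw [Real.rpow_sub_one (hpos s hs).ne']
      apply le_of_eq
      have := hpos s hs
      field_simp
      ring) x
  refine ⟨I, hI.trans ?_⟩
  have : 0 ≤ (T - t₁) ^ (-(1 / 2) : ℝ) := Real.rpow_nonneg (hpos t₁ ⟨le_rfl, ht⟩).le _
  have hn : (0 : ℝ) ≤ n := Nat.cast_nonneg n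
  gcongr
  nlinarith

/-- Since the reaction feeds `v`, the caloric extension of an earlier slice stays below `v`. -/
theorem integral_mul_heatKernel_le_v (h : IsThermoDiffusiveSolution ν κ g u₀ v₀ u v)
    (hg : ∀ r, 0 ≤ r → 0 ≤ g r) (hκ : 0 < κ) {t₁ t : ℝ} (ht₁ : 0 < t₁) (ht : t₁ < t)
    (x : Space n) : ∫ y, v t₁ y * heatKernel (4 * κ * (t - t₁)) (x - y) ≤ v t x := by
  obtain ⟨M, hM⟩ := h.exists_abs_le t
  have ht0 : 0 < t := ht₁.trans ht
  have hθ : 0 < 4 * κ * (t - t₁) := by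
    have : 0 < t - t₁ := by linarith
    positivity
  have hc : ∀ t, 0 < t → Continuous (v t) := fun t ht => (h.regular_v.contDiff_space t ht).continuous
  have lim := tendsto_integral_mul_heatKernel (hc t ht0) (fun y => (hM t ht0 le_rfl y).2) x
    (c := 4 * κ) (by positivity)
  have small : ∀ᶠ s in 𝓝[>] (0 : ℝ), 0 < s ∧ s < t - t₁ := by
    filter_upwards [self_mem_nhdsWithin, mem_nhdsWithin_of_mem_nhds
      (gt_mem_nhds (show 0 < t - t₁ by linarith))] with s hs hst using ⟨hs, hst⟩
  have lim' : Tendsto (fun s => ∫ y, v (t₁ + s) y * heatKernel (4 * κ * (t - t₁)) (x - y))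
      (𝓝[>] 0) (𝓝 (∫ y, v t₁ y * heatKernel (4 * κ * (t - t₁)) (x - y))) := by
    refine tendsto_integral_filter_of_dominated_convergence
      (fun y => M * heatKernel (4 * κ * (t - t₁)) (x - y)) ?_ ?_
      ((integrable_heatKernel hθ x).const_mul M) (Eventually.of_forall fun y => ?_)
    · filter_upwards [small] with s hs
      have := hc (t₁ + s) (by linarith)
      have := continuous_heatKernel (n := n) (4 * κ * (t - t₁))
      exact Continuous.aestronglyMeasurable (by fun_prop)
    · filter_upwards [small] with s hs
      refine Eventually.of_forall fun y => ?_
      rw [norm_mul, Real.norm_of_nonneg (heatKernel_pos hθ _).le]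
      exact mul_le_mul_of_nonneg_right (hM _ (by linarith) (by linarith) _).2
        (heatKernel_pos hθ _).le
    · refine Tendsto.mul_const _ ?_
      have h1 := (h.regular_v.differentiable_time t₁ ht₁ y).continuousAt.tendsto
      have h2 : Tendsto (fun s : ℝ => t₁ + s) (𝓝[>] 0) (𝓝 t₁) := by
        have : Continuous fun s : ℝ => t₁ + s := by fun_prop
        simpa using (this.tendsto 0).mono_left nhdsWithin_le_nhds
      exact h1.comp h2
  refine le_of_tendsto_of_tendsto lim' lim ?_
  filter_upwards [small] with s hs
  -- Shifting both the start and the pole by `s` keeps the initial kernel fixed while the final one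
  -- concentrates at `x`.
  have id := (h.identity_v hg hκ (t₁ := t₁ + s) (t₂ := t) (T := t + s) (by linarith) (by linarith)
    (by linarith) x).2
  rw [add_sub_cancel_left, add_sub_add_right_eq_sub] at id
  have pos : 0 ≤ ∫ p : ℝ × Space n, (u p.1 p.2 * g (v p.1 p.2)) *
      heatKernel (4 * κ * (t + s - p.1)) (x - p.2) ∂slabMeasure n (t₁ + s) t := by
    refine integral_nonneg_of_ae (ae_slabMeasure fun r hr y => ?_)
    have : 0 < t + s - r := by linarith [hr.2]
    exact mul_nonneg (h.reaction_nonneg hg (by linarith [hr.1]) y)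
      (heatKernel_pos (by positivity) _).le
  linarith

end IsThermoDiffusiveSolution


/-! ### Oscillation of the heat kernel on parabolic scales -/

theorem hasDerivAt_heatKernel {n : ℕ} {θ : ℝ → ℝ} {z : ℝ → Space n} {θ' s : ℝ} {z' : Space n}
    (hθ : HasDerivAt θ θ' s) (hz : HasDerivAt z z' s) (h0 : 0 < θ s) :
    HasDerivAt (fun s => heatKernel (θ s) (z s)) (heatKernel (θ s) (z s) *
      ((‖z s‖ ^ 2 / θ s ^ 2 - n / (2 * θ s)) * θ' - 2 * inner ℝ (z s) z' / θ s)) s := by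
  have hπ := mul_pos Real.pi_pos h0
  have h1 := (hθ.const_mul Real.pi).rpow_const (p := -(n / 2 : ℝ)) (Or.inl hπ.ne')
  have h2 := (hz.norm_sq.fun_neg.fun_div hθ h0.ne').exp
  refine (h1.mul h2).congr_deriv ?_
  rw [Real.rpow_sub_one hπ.ne']
  unfold heatKernel
  field_simp
  ring

/-- The heat kernel absorbs a quadratic weight and a bounded displacement. -/
theorem heatKernel_mul_le {n : ℕ} {κ R t : ℝ} (hκ : 0 < κ) (hR : 0 < R) (ht : R ^ 2 ≤ t)
    {z w : Space n} (hzw : ‖w - z‖ ≤ R) :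
    heatKernel (4 * κ * t) z * (1 + ‖z‖ ^ 2 / (4 * κ * t)) ≤
      2 * 4 ^ (n / 2 : ℝ) * Real.exp (1 / (8 * κ)) * heatKernel (4 * (4 * κ * t)) w := by
  have ht0 : 0 < t := (by positivity : 0 < R ^ 2).trans_le ht
  set Θ := 4 * κ * t with hΘ
  have hΘ0 : 0 < Θ := by positivity
  have e1 : (Real.pi * Θ) ^ (-(n / 2 : ℝ)) =
      4 ^ (n / 2 : ℝ) * (Real.pi * (4 * Θ)) ^ (-(n / 2 : ℝ)) := by
    rw [show Real.pi * (4 * Θ) = 4 * (Real.pi * Θ) by ring,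
      Real.mul_rpow (x := 4) (y := Real.pi * Θ) (by norm_num) (by positivity), ← mul_assoc ((4 : ℝ) ^ (n / 2 : ℝ)), ← Real.rpow_add (by norm_num)]
    simp
  have e2 : ‖w‖ ^ 2 ≤ 2 * ‖z‖ ^ 2 + 2 * R ^ 2 := by
    have h1 : ‖w‖ ≤ ‖z‖ + R := by
      have := norm_add_le z (w - z)
      rw [add_sub_cancel] at this
      linarith
    have h2 := pow_le_pow_left₀ (norm_nonneg w) h1 2
    nlinarith [sq_nonneg (‖z‖ - R)]
  -- Half of the Gaussian exponent pays for the weight; in `e4` the other half pays for the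
  -- displacement, at the cost `R² / (2Θ) ≤ 1 / (8κ)`.
  have e3 : 1 + ‖z‖ ^ 2 / Θ ≤ 2 * Real.exp (‖z‖ ^ 2 / Θ / 2) := by
    have := Real.add_one_le_exp (‖z‖ ^ 2 / Θ / 2)
    linarith
  have e4 : -‖z‖ ^ 2 / Θ + ‖z‖ ^ 2 / Θ / 2 ≤ 1 / (8 * κ) + -‖w‖ ^ 2 / (4 * Θ) := by
    have h1 : R ^ 2 / (2 * Θ) ≤ 1 / (8 * κ) := by
      rw [div_le_div_iff₀ (by positivity) (by positivity), hΘ]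
      nlinarith
    have h2 : ‖w‖ ^ 2 / (4 * Θ) ≤ ‖z‖ ^ 2 / Θ / 2 + R ^ 2 / (2 * Θ) := by
      calc ‖w‖ ^ 2 / (4 * Θ) ≤ (2 * ‖z‖ ^ 2 + 2 * R ^ 2) / (4 * Θ) := by gcongr
        _ = _ := by field_simp; ring
    rw [neg_div, neg_div]
    linarith
  unfold heatKernel
  rw [e1]
  calc _ ≤ 4 ^ (n / 2 : ℝ) * (Real.pi * (4 * Θ)) ^ (-(n / 2 : ℝ)) * Real.exp (-‖z‖ ^ 2 / Θ) *
        (2 * Real.exp (‖z‖ ^ 2 / Θ / 2)) := by gcongr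
    _ = 2 * 4 ^ (n / 2 : ℝ) * (Real.pi * (4 * Θ)) ^ (-(n / 2 : ℝ)) *
        Real.exp (-‖z‖ ^ 2 / Θ + ‖z‖ ^ 2 / Θ / 2) := by rw [Real.exp_add]; ring
    _ ≤ 2 * 4 ^ (n / 2 : ℝ) * (Real.pi * (4 * Θ)) ^ (-(n / 2 : ℝ)) *
        Real.exp (1 / (8 * κ) + -‖w‖ ^ 2 / (4 * Θ)) := by gcongr
    _ = _ := by rw [Real.exp_add]; ring

/-- A time change `R²` costs `R² / t ≤ R / √t`. A space change `R` costs `R ‖z‖ / t`, which the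
arithmetic-geometric mean inequality turns into `R / √t` times the quadratic weight. -/
theorem abs_heatKernel_deriv_le {n : ℕ} {κ R t t' : ℝ} (hκ : 0 < κ) (hR : 0 < R) (ht : R ^ 2 ≤ t)
    (ht' : |t'| ≤ R ^ 2) (z : Space n) {z' : Space n} (hz' : ‖z'‖ ≤ R) :
    |heatKernel (4 * κ * t) z * ((‖z‖ ^ 2 / (4 * κ * t) ^ 2 - n / (2 * (4 * κ * t))) *
      (4 * κ * t') - 2 * inner ℝ z z' / (4 * κ * t))| ≤
    (1 + n + (Real.sqrt κ)⁻¹) * (R / Real.sqrt t) *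
      (heatKernel (4 * κ * t) z * (1 + ‖z‖ ^ 2 / (4 * κ * t))) := by
  have ht0 : 0 < t := (by positivity : 0 < R ^ 2).trans_le ht
  have hk := heatKernel_pos (show 0 < 4 * κ * t by positivity) z
  rw [abs_mul, abs_of_pos hk, mul_left_comm ((1 + n + (Real.sqrt κ)⁻¹) * (R / Real.sqrt t))]
  refine mul_le_mul_of_nonneg_left ?_ hk.le
  obtain ⟨p, hp0, hp⟩ : ∃ p, 0 < p ∧ κ = p ^ 2 := ⟨_, Real.sqrt_pos.2 hκ, (Real.sq_sqrt hκ.le).symm⟩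
  obtain ⟨r, hr0, hr⟩ : ∃ r, 0 < r ∧ t = r ^ 2 := ⟨_, Real.sqrt_pos.2 ht0, (Real.sq_sqrt ht0.le).symm⟩
  subst hp hr
  rw [Real.sqrt_sq hp0.le, Real.sqrt_sq hr0.le]
  have hRr : R ≤ r := (sq_le_sq₀ hR.le hr0.le).1 ht
  set q := ‖z‖ ^ 2 / (4 * p ^ 2 * r ^ 2) with hq
  have q0 : 0 ≤ q := by positivity
  have hn : (0 : ℝ) ≤ n := Nat.cast_nonneg n
  have b0 : 0 < R / r := by positivity
  have b1 : R / r ≤ 1 := (div_le_one hr0).2 hRr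
  have T1 : |(‖z‖ ^ 2 / (4 * p ^ 2 * r ^ 2) ^ 2 - n / (2 * (4 * p ^ 2 * r ^ 2))) *
      (4 * p ^ 2 * t')| ≤ (q + n) * (R / r) := by
    have e : (‖z‖ ^ 2 / (4 * p ^ 2 * r ^ 2) ^ 2 - n / (2 * (4 * p ^ 2 * r ^ 2))) *
      (4 * p ^ 2 * t') = (q - n / 2) * (t' / r ^ 2) := by
      rw [hq]; field_simp
    rw [e, abs_mul]
    have h1 : |q - n / 2| ≤ q + n := by
      rw [abs_le]; constructor <;> linarith
    have h2 : |t' / r ^ 2| ≤ R / r := by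
      rw [abs_div, abs_of_pos (by positivity : 0 < r ^ 2)]
      calc |t'| / r ^ 2 ≤ R ^ 2 / r ^ 2 := by gcongr
        _ = (R / r) * (R / r) := by field_simp
        _ ≤ R / r := mul_le_of_le_one_right b0.le b1
    gcongr
  have T2 : |2 * inner ℝ z z' / (4 * p ^ 2 * r ^ 2)| ≤ p⁻¹ * (R / r) * (1 + q) := by
    have h1 : |inner ℝ z z'| ≤ ‖z‖ * R :=
      (abs_real_inner_le_norm z z').trans (by gcongr)
    have h2 : 2 * ‖z‖ * (2 * p * r) ≤ 4 * p ^ 2 * r ^ 2 + ‖z‖ ^ 2 := by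
      nlinarith [sq_nonneg (‖z‖ - 2 * p * r)]
    rw [abs_div, abs_mul, abs_of_pos (by norm_num : (0 : ℝ) < 2),
      abs_of_pos (by positivity : 0 < 4 * p ^ 2 * r ^ 2), div_le_iff₀ (by positivity)]
    have e : p⁻¹ * (R / r) * (1 + q) * (4 * p ^ 2 * r ^ 2) =
        R * (4 * p ^ 2 * r ^ 2 + ‖z‖ ^ 2) / (p * r) := by
      rw [hq]; field_simp
    rw [e, le_div_iff₀ (by positivity)]
    have h3 := mul_le_mul_of_nonneg_left h2 hR.le
    have h4 : 0 ≤ ‖z‖ * R * (p * r) := by positivity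
    have h5 := mul_le_mul_of_nonneg_right h1 (by positivity : 0 ≤ 2 * (p * r))
    nlinarith
  refine (abs_sub _ _).trans ((add_le_add T1 T2).trans ?_)
  have h6 : 0 ≤ n * q * (R / r) := by positivity
  nlinarith

/-- Mean value inequality along the space-time segment joining the two arguments. All intermediate
times are comparable with `S`, so one kernel at `x₀` dominates. In `4κ + ν`, the `4κ` comes from the
widening in `heatKernel_mul_le`, and the `ν` makes the diffusivity admissible for the reaction
bounds. -/
theorem exists_abs_heatKernel_sub_le (n : ℕ) {κ ν : ℝ} (hκ : 0 < κ) (hν : 0 < ν) :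
    ∃ C : ℝ, 0 ≤ C ∧ ∀ (R τ τ' S : ℝ) (x x₀ y : Space n), 0 < R → R ^ 2 ≤ τ → R ^ 2 ≤ τ' →
      |τ - τ'| ≤ R ^ 2 → τ ≤ S → τ' ≤ S → S ≤ 3 * τ → S ≤ 3 * τ' → ‖x - x₀‖ ≤ R →
      |heatKernel (4 * κ * τ) (x - y) - heatKernel (4 * κ * τ') (x₀ - y)| ≤
        C * R * (S ^ (-(1 / 2) : ℝ) * heatKernel (4 * (4 * κ + ν) * S) (x₀ - y)) := by
  refine ⟨(1 + n + (Real.sqrt κ)⁻¹) * Real.sqrt 3 * (2 * 4 ^ (n / 2 : ℝ) *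
    Real.exp (1 / (8 * κ))) * (3 * (4 * κ + ν) / (4 * κ)) ^ (n / 2 : ℝ), by positivity, ?_⟩
  intro R τ τ' S x x₀ y hR hτ hτ' hd hS hS' h3 h3' hx
  have hτ0 : 0 < τ := (by positivity : 0 < R ^ 2).trans_le hτ
  have hS0 : 0 < S := hτ0.trans_le hS
  set t : ℝ → ℝ := fun r => τ' + r * (τ - τ') with ht
  set z : ℝ → Space n := fun r => x₀ - y + r • (x - x₀) with hz
  have bt : ∀ r ∈ Icc (0 : ℝ) 1, R ^ 2 ≤ t r ∧ t r ≤ S ∧ S ≤ 3 * t r := by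
    intro r hr
    have r0 := hr.1
    have r1 : 0 ≤ 1 - r := by linarith [hr.2]
    have e : t r = (1 - r) * τ' + r * τ := by simp only [ht]; ring
    rw [e]
    refine ⟨?_, ?_, ?_⟩ <;> nlinarith
  have dt : ∀ r, HasDerivAt (fun r => 4 * κ * t r) (4 * κ * (τ - τ')) r := fun r => by
    have := (((hasDerivAt_id r).mul_const (τ - τ')).const_add τ').const_mul (4 * κ)
    simpa using this
  have dz : ∀ r, HasDerivAt z (x - x₀) r := fun r => by
    have := ((hasDerivAt_id r).smul_const (x - x₀)).const_add (x₀ - y)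
    exact this.congr_deriv (one_smul _ _)
  have hpos : ∀ r ∈ Icc (0 : ℝ) 1, 0 < 4 * κ * t r := fun r hr => by
    have : 0 < t r := (by positivity : 0 < R ^ 2).trans_le (bt r hr).1
    positivity
  have := norm_image_sub_le_of_norm_deriv_le_segment_01' (f := fun r => heatKernel (4 * κ * t r) (z r))
    (fun r hr => (hasDerivAt_heatKernel (dt r) (dz r) (hpos r hr)).hasDerivWithinAt)
    (C := (1 + n + (Real.sqrt κ)⁻¹) * Real.sqrt 3 * (2 * 4 ^ (n / 2 : ℝ) *
      Real.exp (1 / (8 * κ))) * (3 * (4 * κ + ν) / (4 * κ)) ^ (n / 2 : ℝ) * R *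
      (S ^ (-(1 / 2) : ℝ) * heatKernel (4 * (4 * κ + ν) * S) (x₀ - y)))
    (fun r hr => by
      have hr : r ∈ Icc (0 : ℝ) 1 := ⟨hr.1, hr.2.le⟩
      obtain ⟨c1, c2, c3⟩ := bt r hr
      have c0 : 0 < t r := (by positivity : 0 < R ^ 2).trans_le c1
      have hw : ‖(x₀ - y) - z r‖ ≤ R := by
        simp only [hz, sub_add_cancel_left, norm_neg, norm_smul, Real.norm_of_nonneg hr.1]
        exact (mul_le_of_le_one_left (norm_nonneg _) hr.2).trans hx
      rw [Real.norm_eq_abs]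
      refine (abs_heatKernel_deriv_le hκ hR c1 hd (z r) hx).trans ?_
      have b1 := heatKernel_mul_le hκ hR c1 hw
      have b2 := heatKernel_le_of_le (θ := 4 * (4 * κ * t r)) (θ' := 4 * (4 * κ + ν) * S)
        (by positivity) (by nlinarith) (x₀ - y)
      have b3 : 4 * (4 * κ + ν) * S / (4 * (4 * κ * t r)) ≤ 3 * (4 * κ + ν) / (4 * κ) := by
        rw [div_le_div_iff₀ (by positivity) (by positivity)]
        have := mul_le_mul_of_nonneg_left c3 (by positivity : 0 ≤ 16 * κ * (4 * κ + ν))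
        nlinarith
      have k0 := heatKernel_pos (show 0 < 4 * (4 * κ + ν) * S by positivity) (x₀ - y)
      have b4 : R / Real.sqrt (t r) ≤ Real.sqrt 3 * R * S ^ (-(1 / 2) : ℝ) := by
        rw [Real.rpow_neg hS0.le, ← Real.sqrt_eq_rpow, div_le_iff₀ (Real.sqrt_pos.2 c0)]
        have h1 : Real.sqrt S ≤ Real.sqrt 3 * Real.sqrt (t r) := by
          rw [← Real.sqrt_mul (by norm_num)]
          exact Real.sqrt_le_sqrt c3
        have h2 : 0 < Real.sqrt S := Real.sqrt_pos.2 hS0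
        calc R = R * (Real.sqrt S * (Real.sqrt S)⁻¹) := by field_simp
          _ ≤ R * ((Real.sqrt 3 * Real.sqrt (t r)) * (Real.sqrt S)⁻¹) := by gcongr
          _ = _ := by ring
      calc _ ≤ (1 + n + (Real.sqrt κ)⁻¹) * (Real.sqrt 3 * R * S ^ (-(1 / 2) : ℝ)) *
            (2 * 4 ^ (n / 2 : ℝ) * Real.exp (1 / (8 * κ)) *
            ((3 * (4 * κ + ν) / (4 * κ)) ^ (n / 2 : ℝ) *
              heatKernel (4 * (4 * κ + ν) * S) (x₀ - y))) := by
            refine mul_le_mul (mul_le_mul_of_nonneg_left b4 (by positivity)) (b1.trans ?_)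
              (mul_nonneg (heatKernel_pos (hpos r hr) _).le (by positivity)) (by positivity)
            refine mul_le_mul_of_nonneg_left (b2.trans ?_) (by positivity)
            gcongr
        _ = _ := by ring)
  simpa [ht, hz] using this

/-! ### Contribution of the distant past -/

namespace IsThermoDiffusiveSolution

variable {n : ℕ} {K κ ν : ℝ} {g : ℝ → ℝ} {u₀ v₀ : Space n → ℝ} {u v : ℝ → Space n → ℝ}

/-- The kernel varies with `s`; for `s < t / 2` it is at most `2^(n/2)` times the fixed kernel of
parameter `4κt`. -/
theorem eventually_integral_v_mul_heatKernel_le (h : IsThermoDiffusiveSolution ν κ g u₀ v₀ u v)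
    (hκ : 0 < κ) (hK : 0 < K) (hv₀ : ∀ x, v₀ x ≤ K) {t : ℝ} (ht : 0 < t) (x : Space n) :
    ∀ᶠ s in 𝓝[>] 0, ∫ y, v s y * heatKernel (4 * κ * (t - s)) (x - y) ≤
      2 ^ (n / 2 : ℝ) * (2 * K) := by
  obtain ⟨M, hM⟩ := h.exists_abs_le t
  have hc : ∀ t, 0 < t → Continuous (v t) := fun t ht => (h.regular_v.contDiff_space t ht).continuous
  filter_upwards [h.initial_v.eventually_integral_mul_heatKernel_le hK ht
    (θ := 4 * κ * t) (by positivity) hv₀ hc h.nonneg_v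
    (fun s hs hst y => (le_abs_self _).trans (hM s hs hst y).2) x, self_mem_nhdsWithin,
    mem_nhdsWithin_of_mem_nhds (gt_mem_nhds (half_pos ht))] with s h1 hs hst
  have hs : 0 < s := hs
  have hst : s < t / 2 := hst
  have hts : 0 < t - s := by linarith
  calc _ ≤ ∫ y, 2 ^ (n / 2 : ℝ) * (v s y * heatKernel (4 * κ * t) (x - y)) := by
        refine integral_mono_of_nonneg (Eventually.of_forall fun y => mul_nonneg (h.nonneg_v s hs y)
          (heatKernel_pos (by positivity) _).le) ((integrable_mul_heatKernel (by positivity) x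
          (hc s hs) fun y => (hM s hs (by linarith) y).2).const_mul _)
          (Eventually.of_forall fun y => ?_)
        simp only
        rw [mul_left_comm]
        refine mul_le_mul_of_nonneg_left ?_ (h.nonneg_v s hs y)
        refine (heatKernel_le_of_le (θ' := 4 * κ * t) (by positivity)
          (by gcongr; linarith) _).trans ?_
        refine mul_le_mul_of_nonneg_right ?_ (heatKernel_pos (by positivity) _).le
        refine Real.rpow_le_rpow (by positivity) ?_ (by positivity)
        rw [div_le_iff₀ (by positivity)]
        have : 0 < κ * (t - 2 * s) := mul_pos hκ (by linarith)
        linarith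
    _ ≤ _ := by
        rw [integral_const_mul]
        gcongr

/-- Oscillation of the caloric extension of `v t₁` over a later parabolic cylinder. -/
theorem exists_abs_caloric_sub_le (n : ℕ) {κ ν K : ℝ} (hκ : 0 < κ) (hν : 0 < ν) (hK : 0 < K) :
    ∃ C : ℝ, 0 ≤ C ∧ ∀ (g : ℝ → ℝ) (u₀ v₀ : Space n → ℝ) (u v : ℝ → Space n → ℝ),
      (∀ r, 0 ≤ r → 0 ≤ g r) → (∀ x, u₀ x ≤ K) → (∀ x, v₀ x ≤ K) →
      IsThermoDiffusiveSolution ν κ g u₀ v₀ u v →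
      ∀ (R t t₀ : ℝ) (x x₀ : Space n), 0 < R → 0 < t₀ - 2 * R ^ 2 → |t₀ - t| < R ^ 2 →
      ‖x - x₀‖ ≤ R →
      |(∫ y, v (t₀ - 2 * R ^ 2) y * heatKernel (4 * κ * (t - (t₀ - 2 * R ^ 2))) (x - y)) -
        ∫ y, v (t₀ - 2 * R ^ 2) y * heatKernel (4 * κ * (t₀ - (t₀ - 2 * R ^ 2))) (x₀ - y)| ≤ C := by
  obtain ⟨C, hC0, hC⟩ := exists_abs_heatKernel_sub_le n hκ hν
  refine ⟨2 ^ (n / 2 : ℝ) * (2 * K) + C * (2 * K * (n + 1)), by positivity, ?_⟩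
  intro g u₀ v₀ u v hg hu₀ hv₀ h R t t₀ x x₀ hR ht₁ htt hx
  set t₁ := t₀ - 2 * R ^ 2 with ht₁d
  have hR2 : 0 < R ^ 2 := by positivity
  have hta := abs_lt.1 htt
  have small : ∀ᶠ s in 𝓝[>] (0 : ℝ), 0 < s ∧ s < t₁ := by
    filter_upwards [self_mem_nhdsWithin, mem_nhdsWithin_of_mem_nhds
      (gt_mem_nhds ht₁)] with s hs hst using ⟨hs, hst⟩
  obtain ⟨s, a1, a2, hs0, hst⟩ := ((h.eventually_integral_v_mul_heatKernel_le hκ hK hv₀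
    (t := t) (by linarith) x).and ((h.eventually_integral_v_mul_heatKernel_le hκ hK hv₀
    (t := t₀) (by linarith) x₀).and small)).exists
  obtain ⟨I1, id1⟩ := h.identity_v hg hκ hs0 hst.le (T := t) (by linarith) x
  obtain ⟨I2, id2⟩ := h.identity_v hg hκ hs0 hst.le (T := t₀) (by linarith) x₀
  -- The pole `t₀ + R²` lies above both `t` and `t₀`, so `S = t₀ + R² - r` serves both kernels; `r ≤
  -- t₁` gives the factor 3 comparisons.
  obtain ⟨I3, b3⟩ := h.integral_reaction_mul_rpow_heatKernel_le hg hν hK hu₀ (D := 4 * κ + ν)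
    (by linarith) hs0 hst.le (T := t₀ + R ^ 2) (by linarith) x₀
  have p1 : 0 ≤ ∫ y, v s y * heatKernel (4 * κ * (t - s)) (x - y) := by
    have : 0 < t - s := by linarith
    exact integral_nonneg fun y => mul_nonneg (h.nonneg_v s hs0 y)
      (heatKernel_pos (by positivity) _).le
  have p2 : 0 ≤ ∫ y, v s y * heatKernel (4 * κ * (t₀ - s)) (x₀ - y) := by
    have : 0 < t₀ - s := by linarith
    exact integral_nonneg fun y => mul_nonneg (h.nonneg_v s hs0 y)
      (heatKernel_pos (by positivity) _).le
  have b4 : |(∫ p : ℝ × Space n, (u p.1 p.2 * g (v p.1 p.2)) *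
      heatKernel (4 * κ * (t - p.1)) (x - p.2) ∂slabMeasure n s t₁) -
      ∫ p : ℝ × Space n, (u p.1 p.2 * g (v p.1 p.2)) *
      heatKernel (4 * κ * (t₀ - p.1)) (x₀ - p.2) ∂slabMeasure n s t₁| ≤ C * (2 * K * (n + 1)) := by
    rw [← integral_sub I1 I2, ← Real.norm_eq_abs]
    refine (norm_integral_le_of_norm_le (I3.const_mul (C * R)) (ae_slabMeasure
      fun r hr y => ?_)).trans ?_
    · have F0 := h.reaction_nonneg hg (hs0.trans_le hr.1) y
      have hr2 := hr.2
      rw [← mul_sub, norm_mul, Real.norm_of_nonneg F0, Real.norm_eq_abs]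
      refine (mul_le_mul_of_nonneg_left (hC R (t - r) (t₀ - r) (t₀ + R ^ 2 - r) x x₀ y hR
        (by linarith) (by linarith) (by rw [sub_sub_sub_cancel_right, abs_sub_comm]; exact htt.le)
        (by linarith) (by linarith) (by linarith) (by linarith) hx) F0).trans (le_of_eq ?_)
      ring
    · rw [integral_const_mul]
      refine (mul_le_mul_of_nonneg_left b3 (by positivity)).trans ?_
      -- The pole is `3R²` after `t₁`, so the factor `R` from the kernel difference cancels.
      have e : R * (t₀ + R ^ 2 - t₁) ^ (-(1 / 2) : ℝ) ≤ 1 := by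
        have e1 : t₀ + R ^ 2 - t₁ = 3 * R ^ 2 := by rw [ht₁d]; ring
        rw [e1, Real.rpow_neg (by positivity), ← Real.sqrt_eq_rpow, ← div_eq_mul_inv,
          div_le_one (by positivity)]
        apply Real.le_sqrt_of_sq_le
        linarith
      calc C * R * (2 * K * ((n + 1) * (t₀ + R ^ 2 - t₁) ^ (-(1 / 2) : ℝ)))
          = C * (2 * K * (n + 1)) * (R * (t₀ + R ^ 2 - t₁) ^ (-(1 / 2) : ℝ)) := by ring
        _ ≤ _ := mul_le_of_le_one_right (by positivity) e
  -- Both contributions from time `s` lie in `[0, 2^(n/2) · 2K]`, so their difference is bounded by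
  -- the same number.
  rw [abs_le] at b4 ⊢
  constructor <;> linarith [b4.1, b4.2]

end IsThermoDiffusiveSolution


/-! ### From Gaussian averages to averages over balls -/

theorem integral_integral_mul_heatKernel {n : ℕ} {f : Space n → ℝ} {M α β : ℝ} (hf : Continuous f)
    (hM : ∀ y, |f y| ≤ M) (hα : 0 < α) (hβ : 0 < β) (x₀ : Space n) :
    Integrable (fun x => (∫ y, f y * heatKernel α (x - y)) * heatKernel β (x₀ - x)) ∧
    ∫ x, (∫ y, f y * heatKernel α (x - y)) * heatKernel β (x₀ - x) =
      ∫ y, f y * heatKernel (α + β) (x₀ - y) := by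
  have cα := continuous_heatKernel (n := n) α
  have cβ := continuous_heatKernel (n := n) β
  have I1 : Integrable (fun p : Space n × Space n =>
      M * (heatKernel α (p.1 - p.2) * heatKernel β (x₀ - p.1))) (volume.prod volume) := by
    have hc : Continuous (fun p : Space n × Space n =>
      M * (heatKernel α (p.1 - p.2) * heatKernel β (x₀ - p.1))) := by fun_prop
    rw [integrable_prod_iff hc.aestronglyMeasurable]
    refine ⟨Eventually.of_forall fun x =>
      ((integrable_heatKernel hα x).mul_const (heatKernel β (x₀ - x))).const_mul M, ?_⟩
    simp only [norm_mul, Real.norm_of_nonneg (heatKernel_pos hα _).le,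
      Real.norm_of_nonneg (heatKernel_pos hβ _).le]
    simp_rw [integral_const_mul, integral_mul_const, integral_heatKernel hα, one_mul]
    exact (integrable_heatKernel hβ x₀).const_mul _
  have I2 : Integrable (fun p : Space n × Space n =>
      f p.2 * heatKernel α (p.1 - p.2) * heatKernel β (x₀ - p.1)) (volume.prod volume) := by
    refine I1.mono' (Continuous.aestronglyMeasurable (by fun_prop)) (Eventually.of_forall fun p => ?_)
    rw [norm_mul, norm_mul, Real.norm_of_nonneg (heatKernel_pos hα _).le,
      Real.norm_of_nonneg (heatKernel_pos hβ _).le, mul_assoc]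
    exact mul_le_mul_of_nonneg_right (hM _)
      (mul_nonneg (heatKernel_pos hα _).le (heatKernel_pos hβ _).le)
  have e : ∀ x, (∫ y, f y * heatKernel α (x - y)) * heatKernel β (x₀ - x) =
      ∫ y, f y * heatKernel α (x - y) * heatKernel β (x₀ - x) := fun x =>
    (integral_mul_const _ _).symm
  simp_rw [e]
  refine ⟨I2.integral_prod_left, ?_⟩
  rw [integral_integral_swap (f := fun x y => f y * heatKernel α (x - y) * heatKernel β (x₀ - x)) I2]
  refine integral_congr_ae (Eventually.of_forall fun y => ?_)
  simp only [mul_assoc]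
  rw [integral_const_mul, integral_heatKernel_mul_heatKernel hα hβ]

/-- The range of `β` is that of `4κ(T - t)` for the pole `T = t₀ + 2R²` and `|t - t₀| < R²`. -/
theorem one_le_mul_heatKernel {n : ℕ} {κ R β : ℝ} (hκ : 0 < κ) (hR : 0 < R)
    (h1 : 4 * κ * R ^ 2 ≤ β) (h2 : β ≤ 12 * κ * R ^ 2) {z : Space n} (hz : ‖z‖ ≤ R) :
    1 ≤ (12 * Real.pi * κ) ^ (n / 2 : ℝ) * Real.exp (1 / (4 * κ)) * R ^ n * heatKernel β z := by
  have hβ : 0 < β := lt_of_lt_of_le (by positivity) h1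
  have e1 : 1 ≤ (12 * Real.pi * κ) ^ (n / 2 : ℝ) * R ^ n * (Real.pi * β) ^ (-(n / 2 : ℝ)) := by
    have e : (12 * Real.pi * κ) ^ (n / 2 : ℝ) * R ^ n = (12 * Real.pi * κ * R ^ 2) ^ (n / 2 : ℝ) := by
      rw [Real.mul_rpow (x := 12 * Real.pi * κ) (y := R ^ 2) (by positivity) (by positivity),
        ← Real.rpow_natCast R 2,
        ← Real.rpow_mul hR.le, ← Real.rpow_natCast R n]
      congr 2
      push_cast
      ring
    rw [e, Real.rpow_neg (by positivity), ← div_eq_mul_inv, one_le_div (by positivity)]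
    refine Real.rpow_le_rpow (by positivity) ?_ (by positivity)
    have := mul_le_mul_of_nonneg_left h2 Real.pi_pos.le
    linarith
  have e2 : 1 ≤ Real.exp (1 / (4 * κ)) * Real.exp (-‖z‖ ^ 2 / β) := by
    rw [← Real.exp_add, Real.one_le_exp_iff, neg_div, ← sub_eq_add_neg, sub_nonneg,
      div_le_div_iff₀ hβ (by positivity), one_mul]
    have := mul_le_mul_of_nonneg_right (pow_le_pow_left₀ (norm_nonneg z) hz 2)
      (by positivity : 0 ≤ 4 * κ)
    linarith
  calc 1 ≤ ((12 * Real.pi * κ) ^ (n / 2 : ℝ) * R ^ n * (Real.pi * β) ^ (-(n / 2 : ℝ))) *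
      (Real.exp (1 / (4 * κ)) * Real.exp (-‖z‖ ^ 2 / β)) := one_le_mul_of_one_le_of_one_le e1 e2
    _ = _ := by unfold heatKernel; ring

/-- A Gaussian average controls the integral over a ball. -/
theorem lintegral_ball_le_of_integral_mul_heatKernel_le (n : ℕ) {κ : ℝ} (hκ : 0 < κ) :
    ∃ c : ℝ, 0 ≤ c ∧ ∀ (f : Space n → ℝ) (x₀ : Space n) (R β B : ℝ), 0 < R →
      4 * κ * R ^ 2 ≤ β → β ≤ 12 * κ * R ^ 2 → (∀ x, 0 ≤ f x) →
      Integrable (fun x => f x * heatKernel β (x₀ - x)) →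
      ∫ x, f x * heatKernel β (x₀ - x) ≤ B →
      ∫⁻ x in Metric.ball x₀ R, ENNReal.ofReal (f x) ≤
        ENNReal.ofReal (c * B) * volume (Metric.ball x₀ R) := by
  set ω := (volume (Metric.ball (0 : Space n) 1)).toReal with hω
  have hω0 : 0 < ω := ENNReal.toReal_pos (Metric.measure_ball_pos _ _ one_pos).ne'
    measure_ball_lt_top.ne
  set c := (12 * Real.pi * κ) ^ (n / 2 : ℝ) * Real.exp (1 / (4 * κ)) with hc
  have hc0 : 0 < c := by positivity
  refine ⟨c / ω, by positivity, ?_⟩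
  intro f x₀ R β B hR h1 h2 hf hI hB
  have hβ : 0 < β := lt_of_lt_of_le (by positivity) h1
  have hvol : volume (Metric.ball x₀ R) = ENNReal.ofReal (R ^ n * ω) := by
    rw [Measure.addHaar_ball_of_pos _ _ hR, finrank_euclideanSpace, Fintype.card_fin,
      ENNReal.ofReal_mul (by positivity), hω, ENNReal.ofReal_toReal measure_ball_lt_top.ne]
  have hB0 : 0 ≤ B := le_trans (integral_nonneg fun x =>
    mul_nonneg (hf x) (heatKernel_pos hβ _).le) hB
  calc _ ≤ ∫⁻ x in Metric.ball x₀ R, ENNReal.ofReal (c * R ^ n * (f x * heatKernel β (x₀ - x))) := by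
        refine setLIntegral_mono' Metric.isOpen_ball.measurableSet fun x hx => ?_
        apply ENNReal.ofReal_le_ofReal
        rw [Metric.mem_ball, dist_comm, dist_eq_norm] at hx
        have := mul_le_mul_of_nonneg_left (one_le_mul_heatKernel hκ hR h1 h2 hx.le) (hf x)
        rw [mul_one] at this
        refine this.trans (le_of_eq ?_)
        rw [hc]
        ring
    _ ≤ ∫⁻ x, ENNReal.ofReal (c * R ^ n * (f x * heatKernel β (x₀ - x))) := setLIntegral_le_lintegral _ _
    _ = ENNReal.ofReal (∫ x, c * R ^ n * (f x * heatKernel β (x₀ - x))) :=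
        (ofReal_integral_eq_lintegral_ofReal (hI.const_mul _) (Eventually.of_forall fun x =>
          mul_nonneg (by positivity) (mul_nonneg (hf x) (heatKernel_pos hβ _).le))).symm
    _ ≤ ENNReal.ofReal (c * R ^ n * B) := by
        rw [integral_const_mul]
        gcongr
    _ = _ := by
        rw [hvol, ← ENNReal.ofReal_mul (by positivity)]
        congr 1
        field_simp

/-! ### Mean oscillation of time slices -/

namespace IsThermoDiffusiveSolution

/-- On every parabolic cylinder in the upper half-space, the time slices of `v` are close in mean to
one constant. -/
theorem exists_lintegral_ball_sub_const_le (n : ℕ) {κ ν K : ℝ} (hκ : 0 < κ) (hν : 0 < ν)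
    (hK : 0 < K) :
    ∃ C : ℝ, 0 ≤ C ∧ ∀ (g : ℝ → ℝ) (u₀ v₀ : Space n → ℝ) (u v : ℝ → Space n → ℝ),
      (∀ r, 0 ≤ r → 0 ≤ g r) → (∀ x, u₀ x ≤ K) → (∀ x, v₀ x ≤ K) →
      IsThermoDiffusiveSolution ν κ g u₀ v₀ u v →
      ∀ (R t₀ : ℝ) (x₀ : Space n), 0 < R → R ^ 2 ≤ t₀ → ∃ m : ℝ, ∀ t, |t₀ - t| < R ^ 2 →
      ∫⁻ x in Metric.ball x₀ R, ‖v t x - m‖ₑ ≤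
        ENNReal.ofReal C * volume (Metric.ball x₀ R) := by
  obtain ⟨c, hc0, hc⟩ := lintegral_ball_le_of_integral_mul_heatKernel_le n hκ
  obtain ⟨E, hE0, hE⟩ := exists_abs_caloric_sub_le n hκ hν hK
  set B := 2 * K * ((κ + ν) / κ) ^ (n / 2 : ℝ) * 4 ^ (n / 2 : ℝ) with hB
  have hB0 : 0 ≤ B := by positivity
  refine ⟨c * (B + 2 ^ (n / 2 : ℝ) * (2 * K)) + E, by positivity, ?_⟩
  intro g u₀ v₀ u v hg hu₀ hv₀ h R t₀ x₀ hR hRt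
  have hR2 : 0 < R ^ 2 := by positivity
  have hcv : ∀ t, 0 < t → Continuous (v t) := fun t ht =>
    (h.regular_v.contDiff_space t ht).continuous
  obtain ⟨M, hM⟩ := h.exists_abs_le (t₀ + R ^ 2)
  -- Here `T - t > R²` and `T - s ≤ 4R²` for `T = t₀ + 2R²`, which accounts for `4^(n/2)` in `B`.
  have near : ∀ s t, 0 < s → s ≤ t → |t₀ - t| < R ^ 2 → t₀ - 2 * R ^ 2 ≤ s →
      (∫ y, v t y * heatKernel (4 * κ * (t₀ + 2 * R ^ 2 - t)) (x₀ - y)) -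
      ∫ y, v s y * heatKernel (4 * κ * (t₀ + 2 * R ^ 2 - s)) (x₀ - y) ≤ B := by
    intro s t hs hst ht hs2
    have hta := abs_lt.1 ht
    rw [(h.identity_v hg hκ hs hst (T := t₀ + 2 * R ^ 2) (by linarith) x₀).2]
    refine (h.integral_reaction_mul_heatKernel_le hg hν hκ hK hu₀ hs hst
      (T := t₀ + 2 * R ^ 2) (by linarith) x₀).trans ?_
    have h1 : 0 < t₀ + 2 * R ^ 2 - t := by linarith
    have h2 : 0 < t₀ + 2 * R ^ 2 - s := by linarith
    rw [hB]
    gcongr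
    rw [div_le_iff₀ h1]
    linarith
  rcases lt_or_ge 0 (t₀ - 2 * R ^ 2) with hA | hA
  · set t₁ := t₀ - 2 * R ^ 2 with ht₁
    refine ⟨∫ y, v t₁ y * heatKernel (4 * κ * (t₀ - t₁)) (x₀ - y), fun t ht => ?_⟩
    set m := ∫ y, v t₁ y * heatKernel (4 * κ * (t₀ - t₁)) (x₀ - y) with hm
    have hta := abs_lt.1 ht
    have ht0 : 0 < t := by linarith
    have ht₁t : t₁ < t := by linarith
    have hα : 0 < 4 * κ * (t - t₁) := by
      have : 0 < t - t₁ := by linarith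
      positivity
    have hβ : 0 < 4 * κ * (t₀ + 2 * R ^ 2 - t) := by
      have : 0 < t₀ + 2 * R ^ 2 - t := by linarith
      positivity
    set H : Space n → ℝ := fun x => ∫ y, v t₁ y * heatKernel (4 * κ * (t - t₁)) (x - y) with hH
    obtain ⟨IH, eH⟩ := integral_integral_mul_heatKernel (hcv t₁ hA)
      (fun y => (hM t₁ hA (by linarith) y).2) hα hβ x₀
    have Iv := integrable_mul_heatKernel hβ x₀ (hcv t ht0) fun y => (hM t ht0 (by linarith) y).2
    have es : 4 * κ * (t - t₁) + 4 * κ * (t₀ + 2 * R ^ 2 - t) =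
      4 * κ * (t₀ + 2 * R ^ 2 - t₁) := by ring
    -- By the semigroup property, averaging `H` against the kernel with pole `t₀ + 2R²` gives the
    -- same kernel tested on `v t₁`, so `near` bounds the average of `v t - H`.
    have ball := hc (fun x => v t x - H x) x₀ R (4 * κ * (t₀ + 2 * R ^ 2 - t)) B hR
      (by gcongr; linarith)
      (by
        have := mul_le_mul_of_nonneg_left (show t₀ + 2 * R ^ 2 - t ≤ 3 * R ^ 2 by linarith)
          (by positivity : 0 ≤ 4 * κ)
        linarith)
      (fun x => sub_nonneg.2 (h.integral_mul_heatKernel_le_v hg hκ hA ht₁t x))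
      (by simp_rw [sub_mul]; exact Iv.sub IH)
      (by
        simp_rw [sub_mul]
        rw [integral_sub Iv IH, eH, es]
        exact near t₁ t hA ht₁t.le ht le_rfl)
    calc ∫⁻ x in Metric.ball x₀ R, ‖v t x - m‖ₑ
        ≤ ∫⁻ x in Metric.ball x₀ R, (ENNReal.ofReal (v t x - H x) + ENNReal.ofReal E) := by
          refine setLIntegral_mono' Metric.isOpen_ball.measurableSet fun x hx => ?_
          rw [Metric.mem_ball, dist_eq_norm] at hx
          have h1 := h.integral_mul_heatKernel_le_v hg hκ hA ht₁t x
          have h2 := hE g u₀ v₀ u v hg hu₀ hv₀ h R t t₀ x x₀ hR hA ht hx.le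
          rw [← ENNReal.ofReal_add (sub_nonneg.2 h1) hE0, ← ofReal_norm, Real.norm_eq_abs]
          apply ENNReal.ofReal_le_ofReal
          calc |v t x - m| = |(v t x - H x) + (H x - m)| := by ring_nf
            _ ≤ |v t x - H x| + |H x - m| := abs_add_le _ _
            _ ≤ _ := add_le_add (abs_of_nonneg (sub_nonneg.2 h1)).le h2
      _ = (∫⁻ x in Metric.ball x₀ R, ENNReal.ofReal (v t x - H x)) +
          ENNReal.ofReal E * volume (Metric.ball x₀ R) := by
          rw [lintegral_add_right _ measurable_const, setLIntegral_const]
      _ ≤ ENNReal.ofReal (c * B) * volume (Metric.ball x₀ R) +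
          ENNReal.ofReal E * volume (Metric.ball x₀ R) := by gcongr
      _ ≤ _ := by
          rw [← add_mul, ← ENNReal.ofReal_add (by positivity) hE0]
          gcongr
          exact le_add_of_nonneg_right (by positivity)
  -- The cylinder is close to the initial time: `near` started at a tiny `s`, with the bound
  -- inherited from `v₀`, controls `v` itself.
  · refine ⟨0, fun t ht => ?_⟩
    have hta := abs_lt.1 ht
    have ht0 : 0 < t := by linarith
    have hβ : 0 < 4 * κ * (t₀ + 2 * R ^ 2 - t) := by
      have : 0 < t₀ + 2 * R ^ 2 - t := by linarith
      positivity
    have Iv := integrable_mul_heatKernel hβ x₀ (hcv t ht0) fun y => (hM t ht0 (by linarith) y).2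
    have small : ∀ᶠ s in 𝓝[>] (0 : ℝ), 0 < s ∧ s < t := by
      filter_upwards [self_mem_nhdsWithin, mem_nhdsWithin_of_mem_nhds
        (gt_mem_nhds ht0)] with s hs hst using ⟨hs, hst⟩
    obtain ⟨s, hs1, hs0, hst⟩ := ((h.eventually_integral_v_mul_heatKernel_le hκ hK hv₀
      (t := t₀ + 2 * R ^ 2) (by linarith) x₀).and small).exists
    have ball := hc (v t) x₀ R (4 * κ * (t₀ + 2 * R ^ 2 - t)) (B + 2 ^ (n / 2 : ℝ) * (2 * K)) hR
      (by gcongr; linarith)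
      (by
        have := mul_le_mul_of_nonneg_left (show t₀ + 2 * R ^ 2 - t ≤ 3 * R ^ 2 by linarith)
          (by positivity : 0 ≤ 4 * κ)
        linarith)
      (h.nonneg_v t ht0) Iv
      (by linarith [near s t hs0 hst.le ht (by linarith)])
    calc ∫⁻ x in Metric.ball x₀ R, ‖v t x - 0‖ₑ
        = ∫⁻ x in Metric.ball x₀ R, ENNReal.ofReal (v t x) := by
          refine lintegral_congr fun x => ?_
          rw [sub_zero, Real.enorm_eq_ofReal (h.nonneg_v t ht0 x)]
      _ ≤ _ := ball
      _ ≤ _ := by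
          gcongr
          exact le_add_of_nonneg_right hE0

end IsThermoDiffusiveSolution

/-! ### Parabolic cylinders and conclusion -/

theorem parabolicCylinder_eq_prod {n : ℕ} (R t : ℝ) (x : Space n) :
    parabolicCylinder R t x = Ioo (t - R ^ 2) (t + R ^ 2) ×ˢ Metric.ball x R := by
  ext ⟨s, y⟩
  simp only [parabolicCylinder, mem_ofPred_eq, mem_prod, mem_Ioo, Metric.mem_ball, abs_lt,
    dist_comm y x, dist_eq_norm]
  constructor
  · rintro ⟨h1, h2, h3⟩
    exact ⟨⟨by linarith, by linarith⟩, h1⟩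
  · rintro ⟨⟨h1, h2⟩, h3⟩
    exact ⟨h3, by linarith, by linarith⟩

theorem sq_le_of_parabolicCylinder_subset {n : ℕ} {R t : ℝ} {x : Space n} (hR : 0 < R)
    (h : parabolicCylinder R t x ⊆ upperHalfSpace n) : R ^ 2 ≤ t := by
  by_contra! hlt
  have hR2 : 0 < R ^ 2 := by positivity
  -- The minimum also covers `t ≤ 0`: either way this is a point of the cylinder at nonpositive
  -- time.
  have : (min t 0, x) ∈ parabolicCylinder R t x := by
    rw [parabolicCylinder_eq_prod]
    refine ⟨⟨?_, ?_⟩, Metric.mem_ball_self hR⟩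
    · exact lt_min (by linarith) (by linarith)
    · exact (min_le_left _ _).trans_lt (by linarith)
  have h2 : 0 < min t 0 := (h this).1
  exact absurd h2 (not_lt.2 (min_le_right _ _))

/-- The mean oscillation is at most twice the mean distance to any constant. -/
theorem meanOscillation_le {n : ℕ} {f : ℝ × Space n → ℝ} {Q : Set (ℝ × Space n)}
    (hf : IntegrableOn f Q) (h0 : volume Q ≠ 0) (h1 : volume Q ≠ ∞) (m : ℝ) {C : ℝ≥0∞}
    (hC : ∫⁻ p in Q, ‖f p - m‖ₑ ≤ C * volume Q) : meanOscillation f Q ≤ 2 * C := by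
  have : IsFiniteMeasure (volume.restrict Q) := ⟨by simpa using h1.lt_top⟩
  have hm : IntegrableOn (fun _ => m) Q := integrable_const m
  have e : (⨍ q in Q, f q) - m = ⨍ q in Q, (f q - m) := by
    have hr : (volume.real Q) ≠ 0 := (ENNReal.toReal_pos h0 h1).ne'
    rw [setAverage_eq, setAverage_eq, integral_sub hf hm, setIntegral_const]
    simp only [smul_eq_mul]
    field_simp
  have a : ‖m - ⨍ q in Q, f q‖ₑ * volume Q ≤ C * volume Q := by
    rw [← enorm_neg, neg_sub, e, setAverage_eq, enorm_smul, mul_comm (_ * _), ← mul_assoc]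
    refine (mul_le_mul_right ((enorm_integral_le_lintegral_enorm _).trans hC) _).trans ?_
    rw [Real.enorm_eq_ofReal (by positivity), measureReal_def, ← ENNReal.toReal_inv,
      ENNReal.ofReal_toReal (ENNReal.inv_ne_top.2 h0), ENNReal.mul_inv_cancel h0 h1, one_mul]
  unfold meanOscillation
  rw [ENNReal.div_le_iff h0 h1]
  calc _ ≤ ∫⁻ p in Q, (‖f p - m‖ₑ + ‖m - ⨍ q in Q, f q‖ₑ) := by
        refine lintegral_mono fun p => ?_
        have := enorm_add_le (f p - m) (m - ⨍ q in Q, f q)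
        rwa [sub_add_sub_cancel] at this
    _ = (∫⁻ p in Q, ‖f p - m‖ₑ) + ‖m - ⨍ q in Q, f q‖ₑ * volume Q := by
        rw [lintegral_add_right _ measurable_const, setLIntegral_const]
    _ ≤ C * volume Q + C * volume Q := add_le_add hC a
    _ = _ := by ring

theorem proposition2p1 (n : ℕ) (hn : 1 ≤ n) (K κ ν : ℝ) (hK : 0 < K) (hκ : 0 < κ) (hν : 0 < ν) :
    ∃ C₁ : ℝ≥0, ∀ (g : ℝ → ℝ) (u₀ v₀ : Space n → ℝ) (u v : ℝ → Space n → ℝ),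
      (∀ r, 0 ≤ r → 0 ≤ g r) →
      AEMeasurable u₀ volume → AEMeasurable v₀ volume →
      (∀ x, 0 ≤ u₀ x ∧ u₀ x ≤ K) → (∀ x, 0 ≤ v₀ x ∧ v₀ x ≤ K) →
      IsThermoDiffusiveSolution ν κ g u₀ v₀ u v →
      parabolicBMOSeminorm (upperHalfSpace n) (fun p => v p.1 p.2) ≤ C₁ := by
  obtain ⟨C, hC0, hC⟩ :=
    IsThermoDiffusiveSolution.exists_lintegral_ball_sub_const_le n hκ hν hK
  refine ⟨2 * C.toNNReal, ?_⟩
  intro g u₀ v₀ u v hg _ _ hu₀ hv₀ h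
  refine iSup_le fun R => iSup_le fun t₀ => iSup_le fun x₀ => iSup_le fun hR => iSup_le fun hQ => ?_
  obtain ⟨m, hm⟩ := hC g u₀ v₀ u v hg (fun x => (hu₀ x).2) (fun x => (hv₀ x).2) h R t₀ x₀ hR
    (sq_le_of_parabolicCylinder_subset hR hQ)
  obtain ⟨M, hM⟩ := h.exists_abs_le (t₀ + R ^ 2)
  have hR2 : 0 < R ^ 2 := by positivity
  set Q := parabolicCylinder R t₀ x₀ with hQd
  have eQ : Q = Ioo (t₀ - R ^ 2) (t₀ + R ^ 2) ×ˢ Metric.ball x₀ R := parabolicCylinder_eq_prod R t₀ x₀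
  have mQ : MeasurableSet Q := by
    rw [eQ]; exact measurableSet_Ioo.prod Metric.isOpen_ball.measurableSet
  have vQ : volume Q = volume (Ioo (t₀ - R ^ 2) (t₀ + R ^ 2)) * volume (Metric.ball x₀ R) := by
    rw [eQ, Measure.volume_eq_prod, Measure.prod_prod]
  have h1 : volume Q ≠ ∞ := by
    rw [vQ]
    exact ENNReal.mul_ne_top measure_Ioo_lt_top.ne measure_ball_lt_top.ne
  have h0 : volume Q ≠ 0 := by
    rw [vQ]
    refine mul_ne_zero ?_ (Metric.measure_ball_pos _ _ hR).ne'
    rw [Real.volume_Ioo]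
    simp [hR.ne']
  have cv : ContinuousOn (fun p : ℝ × Space n => v p.1 p.2) Q := h.regular_v.continuous_self.mono hQ
  have hv : IntegrableOn (fun p : ℝ × Space n => v p.1 p.2) Q := by
    have : IsFiniteMeasure (volume.restrict Q) := ⟨by simpa using h1.lt_top⟩
    refine Integrable.of_bound (cv.aestronglyMeasurable mQ) M ?_
    filter_upwards [ae_restrict_mem mQ] with p hp
    have ht : p.1 ≤ t₀ + R ^ 2 := by
      rw [eQ] at hp
      exact hp.1.2.le
    exact (hM p.1 (hQ hp).1 ht p.2).2
  -- The constant `m` is the same for all slices of the cylinder, so Tonelli's theorem integrates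
  -- the slice bound in time.
  have key : ∫⁻ p in Q, ‖v p.1 p.2 - m‖ₑ ≤ ENNReal.ofReal C * volume Q := by
    have ae : AEMeasurable (fun p : ℝ × Space n => ‖v p.1 p.2 - m‖ₑ)
        ((volume.restrict (Ioo (t₀ - R ^ 2) (t₀ + R ^ 2))).prod
          (volume.restrict (Metric.ball x₀ R))) := by
      rw [Measure.prod_restrict, ← Measure.volume_eq_prod, ← eQ]
      exact ((cv.sub continuousOn_const).aestronglyMeasurable mQ).enorm
    rw [vQ, eQ, Measure.volume_eq_prod, ← Measure.prod_restrict, lintegral_prod _ ae]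
    calc _ ≤ ∫⁻ _ in Ioo (t₀ - R ^ 2) (t₀ + R ^ 2),
          ENNReal.ofReal C * volume (Metric.ball x₀ R) := by
          refine setLIntegral_mono' measurableSet_Ioo fun t ht => hm t ?_
          rw [abs_lt]
          constructor <;> linarith [ht.1, ht.2]
      _ = _ := by rw [setLIntegral_const]; ring
  refine (meanOscillation_le hv h0 h1 m key).trans (le_of_eq ?_)
  push_cast
  rfl
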